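/- Let $\mathbb{S}^{d-1}=\{x\in\mathbb{R}^d:\|x\|_2=1\}$ and, for integers $t\ge 0$, $d\ge 1$, let $N_{t,d}=\binom{t+d-1}{d-1}$. For odd $t$, points $x_1,\dots,x_r\in\mathbb{S}^{d-1}$ are said to form a spherical $t$-design if $$\mathbf{E}_{x\sim\mathcal U(\mathbb{S}^{d-1})}[p(x)]=\frac1r\sum_{i=1}^r p(x_i)$$ for every homogeneous real polynomial $p$ of degree $t$ in $d$ variables, where $\mathcal U(\mathbb{S}^{d-1})$ is the uniform distribution on $\mathbb{S}^{d-1}$. There is an absolute constant $C>0$ such that the following holds for every odd positive integer $t$, every integer $d\ge 2$ and every integer $r\ge N_{2t,d}^5$. Let $y_1,\dots,y_r$ be independent random vectors, each uniformly distributed on $\mathbb{S}^{d-1}$. Then, with probability at least $99/100$, there exist unit vectors $z_1,\dots,z_r\in\mathbb{S}^{d-1}$ such that $\|z_i-y_i\|_2\le C/N_{2t,d}$ for all $i\in\{1,\dots,r\}$ and $(z_1,\dots,z_r)$ form a spherical $t$-design. -/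

import Mathlib

open MeasureTheory ProbabilityTheory

/-- The unit sphere `S^{d-1}` of `ℝ^d` with the Euclidean norm. -/
abbrev UnitSphere (d : ℕ) : Type :=
  Metric.sphere (0 : EuclideanSpace ℝ (Fin d)) 1

/-- The uniform distribution on `S^{d-1}`: the surface measure induced by Lebesgue measure on `ℝ^d`,
divided by its total mass (which is positive and finite as soon as `1 ≤ d`). -/
noncomputable def uniformSphere (d : ℕ) : Measure (UnitSphere d) :=
  ((volume : Measure (EuclideanSpace ℝ (Fin d))).toSphere Set.univ)⁻¹ •
    (volume : Measure (EuclideanSpace ℝ (Fin d))).toSphere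

/-- The value at a point of the sphere of a real polynomial in `d` variables. -/
noncomputable def sphereEval {d : ℕ} (p : MvPolynomial (Fin d) ℝ) (x : UnitSphere d) : ℝ :=
  MvPolynomial.eval (fun j => (x : EuclideanSpace ℝ (Fin d)) j) p

/-- `x_1, …, x_r ∈ S^{d-1}` form a spherical `t`-design (`t` odd): for every homogeneous polynomial
of degree `t`, its mean over the sphere is its average over the points. -/
def IsSphericalDesign {d r : ℕ} (t : ℕ) (x : Fin r → UnitSphere d) : Prop :=
  ∀ p : MvPolynomial (Fin d) ℝ, p.IsHomogeneous t →
    ∫ u, sphereEval p u ∂(uniformSphere d) = (1 / (r : ℝ)) * ∑ i, sphereEval p (x i)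

/-- `N_{t,d} = C(t + d - 1, d - 1)`, the dimension of the space of homogeneous polynomials of
degree `t` in `d ≥ 1` variables. -/
def homogDim (t d : ℕ) : ℕ := (t + d - 1).choose (d - 1)

/-! For odd `t` every homogeneous polynomial of degree `t` has mean zero on the sphere, so a design
is exactly a tuple at which the empirical means of an L²-orthonormal basis vanish (the vector
`average`). Let `n ≤ homogDim t d` be the size of that basis and `N = homogDim (2 * t) d`. For
independent uniform points, second moments and Markov's inequality give with probability at least
99/100 both an average of norm `ε = O(√(homogDim t d / r))` and an empirical Gram matrix within 1/4
of the identity in Frobenius norm, that is, a Marcinkiewicz–Zygmund inequality.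

From such points `y`, minimise `‖average z‖` plus multiples `l1`, `l2` of the sup distance and the
Euclidean distance from `z` to `y`; compactness provides a minimiser. If its average is nonzero, let
`p` be the unit polynomial whose coefficients are the normalised average. A Poincaré inequality
(`exists_sphereNormSq_le_rotationDeriv`) yields a coordinate plane in which the infinitesimal
rotation `q` of `p` has norm at least `1 / (π d)`. Rotating each `z i` in that plane at speed `-q (z
i)` lowers `‖average‖` at the rate `M`, the mean of `q (z i) ^ 2` (`exists_descent`), while the
penalties grow at rate at most `l1 √n ‖q‖ + l2 √(r M)`. The Marcinkiewicz–Zygmund inequality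
survives the passage from `y` to `z`, so `M ≥ ‖q‖² / 4`, and for suitable `l1`, `l2` the decrease
wins, a contradiction.

Comparing the minimiser with `y` bounds the displacement by `ε / l1`, which is small because
`homogDim t d * d ≤ 2 * N` and `r ≥ N ^ 5`. The analytic inputs are the reproducing kernel identity
`sum_sphereEval_sq` and a Bernstein inequality along plane rotations, which make polynomials
Lipschitz on the sphere. For bounded `N` the permitted displacement exceeds the diameter 2, and any
explicit design suffices. -/

/-! ### Isometry invariance of the uniform measure and polynomials on the sphere -/

/-- The action of a linear isometry on the sphere. -/
noncomputable def sphereMap {d : ℕ}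
    (g : EuclideanSpace ℝ (Fin d) ≃ₗᵢ[ℝ] EuclideanSpace ℝ (Fin d)) (x : UnitSphere d) :
    UnitSphere d :=
  ⟨g x, by simp⟩

@[simp]
theorem coe_sphereMap {d : ℕ} (g : EuclideanSpace ℝ (Fin d) ≃ₗᵢ[ℝ] EuclideanSpace ℝ (Fin d))
    (x : UnitSphere d) : (sphereMap g x : EuclideanSpace ℝ (Fin d)) = g x := rfl

theorem continuous_sphereMap {d : ℕ}
    (g : EuclideanSpace ℝ (Fin d) ≃ₗᵢ[ℝ] EuclideanSpace ℝ (Fin d)) :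
    Continuous (sphereMap g) :=
  Continuous.subtype_mk (g.continuous.comp continuous_subtype_val) _

open scoped Pointwise in
-- The surface measure of a set is a multiple of the volume of the cone over it; a linear isometry
-- preserves volume and maps cones to cones.
theorem measurePreserving_sphereMap_toSphere {d : ℕ}
    (g : EuclideanSpace ℝ (Fin d) ≃ₗᵢ[ℝ] EuclideanSpace ℝ (Fin d)) :
    MeasurePreserving (sphereMap g) (volume : Measure (EuclideanSpace ℝ (Fin d))).toSphere
      (volume : Measure (EuclideanSpace ℝ (Fin d))).toSphere := by
  refine ⟨(continuous_sphereMap g).measurable, ?_⟩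
  ext s hs
  have hm := (continuous_sphereMap g).measurable hs
  rw [Measure.map_apply (continuous_sphereMap g).measurable hs,
    Measure.toSphere_apply' _ hm, Measure.toSphere_apply' _ hs]
  congr 1
  rw [← g.measurePreserving.measure_preimage_emb g.toHomeomorph.measurableEmbedding
    (Set.Ioo (0 : ℝ) 1 • (Subtype.val '' s))]
  congr 1
  ext v
  simp only [Set.mem_smul, Set.mem_image, Set.mem_preimage, exists_exists_and_eq_and]
  constructor
  · rintro ⟨c, hc, x, hx, rfl⟩
    exact ⟨c, hc, sphereMap g x, hx, by simp⟩
  · rintro ⟨c, hc, x, hx, h⟩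
    refine ⟨c, hc, sphereMap g.symm x, ?_, ?_⟩
    · convert hx
      ext1
      simp
    · apply g.injective
      rw [← h]
      simp

theorem measurePreserving_sphereMap {d : ℕ}
    (g : EuclideanSpace ℝ (Fin d) ≃ₗᵢ[ℝ] EuclideanSpace ℝ (Fin d)) :
    MeasurePreserving (sphereMap g) (uniformSphere d) (uniformSphere d) := by
  have h := measurePreserving_sphereMap_toSphere g
  exact ⟨h.measurable, by rw [uniformSphere, Measure.map_smul, h.map_eq]⟩

instance {d : ℕ} [NeZero d] : IsProbabilityMeasure (uniformSphere d) := by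
  have : Nontrivial (EuclideanSpace ℝ (Fin d)) :=
    Module.nontrivial_of_finrank_pos (R := ℝ) (by simp [Nat.pos_of_neZero])
  have h := Measure.toSphere_ne_zero (volume : Measure (EuclideanSpace ℝ (Fin d)))
  constructor
  rw [uniformSphere, Measure.smul_apply, smul_eq_mul]
  exact ENNReal.inv_mul_cancel (by rwa [Ne, Measure.measure_univ_eq_zero]) (measure_ne_top _ _)

instance {d : ℕ} : (uniformSphere d).IsOpenPosMeasure :=
  Measure.isOpenPosMeasure_smul _ (ENNReal.inv_ne_zero.2 (measure_ne_top _ _))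

theorem integral_comp_sphereMap {d : ℕ}
    (g : EuclideanSpace ℝ (Fin d) ≃ₗᵢ[ℝ] EuclideanSpace ℝ (Fin d)) (f : UnitSphere d → ℝ) :
    ∫ x, f (sphereMap g x) ∂(uniformSphere d) = ∫ x, f x ∂(uniformSphere d) := by
  apply (measurePreserving_sphereMap g).integral_comp
  refine (Homeomorph.mk ⟨sphereMap g, sphereMap g.symm, fun x => ?_, fun x => ?_⟩
    (continuous_sphereMap g) (continuous_sphereMap g.symm)).measurableEmbedding
  · ext1; simp
  · ext1; simp

theorem continuous_sphereEval {d : ℕ} (p : MvPolynomial (Fin d) ℝ) : Continuous (sphereEval p) := by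
  unfold sphereEval
  refine (MvPolynomial.continuous_eval p).comp ?_
  fun_prop

theorem integrable_of_continuous {d : ℕ} [NeZero d] {f : UnitSphere d → ℝ} (hf : Continuous f) :
    Integrable f (uniformSphere d) :=
  hf.integrable_of_hasCompactSupport (HasCompactSupport.of_compactSpace f)

@[simp]
theorem sphereEval_add {d : ℕ} (p q : MvPolynomial (Fin d) ℝ) (x : UnitSphere d) :
    sphereEval (p + q) x = sphereEval p x + sphereEval q x := by simp [sphereEval]

@[simp]
theorem sphereEval_sub {d : ℕ} (p q : MvPolynomial (Fin d) ℝ) (x : UnitSphere d) :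
    sphereEval (p - q) x = sphereEval p x - sphereEval q x := by simp [sphereEval]

@[simp]
theorem sphereEval_smul {d : ℕ} (c : ℝ) (p : MvPolynomial (Fin d) ℝ) (x : UnitSphere d) :
    sphereEval (c • p) x = c * sphereEval p x := by simp [sphereEval]

@[simp]
theorem sphereEval_sum {d : ℕ} {ι : Type*} (s : Finset ι) (p : ι → MvPolynomial (Fin d) ℝ)
    (x : UnitSphere d) : sphereEval (∑ i ∈ s, p i) x = ∑ i ∈ s, sphereEval (p i) x := by
  simp [sphereEval]

/-- Substitution of a linear map into a polynomial. -/
noncomputable def substLinear {d : ℕ}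
    (g : EuclideanSpace ℝ (Fin d) ≃ₗᵢ[ℝ] EuclideanSpace ℝ (Fin d)) (p : MvPolynomial (Fin d) ℝ) :
    MvPolynomial (Fin d) ℝ :=
  MvPolynomial.aeval (fun j => ∑ k, MvPolynomial.C ((g (EuclideanSpace.single k 1)) j) *
    MvPolynomial.X k : Fin d → MvPolynomial (Fin d) ℝ) p

theorem isHomogeneous_substLinear {d t : ℕ}
    (g : EuclideanSpace ℝ (Fin d) ≃ₗᵢ[ℝ] EuclideanSpace ℝ (Fin d)) {p : MvPolynomial (Fin d) ℝ}
    (hp : p.IsHomogeneous t) : (substLinear g p).IsHomogeneous t := by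
  have := hp.aeval (fun j => ∑ k, MvPolynomial.C ((g (EuclideanSpace.single k 1)) j) *
    MvPolynomial.X k : Fin d → MvPolynomial (Fin d) ℝ) (n := 1) fun j =>
      MvPolynomial.IsHomogeneous.sum _ _ _ fun k _ => MvPolynomial.isHomogeneous_C_mul_X _ _
  rwa [one_mul] at this

@[simp]
theorem sphereEval_substLinear {d : ℕ}
    (g : EuclideanSpace ℝ (Fin d) ≃ₗᵢ[ℝ] EuclideanSpace ℝ (Fin d)) (p : MvPolynomial (Fin d) ℝ)
    (x : UnitSphere d) : sphereEval (substLinear g p) x = sphereEval p (sphereMap g x) := by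
  have h : ∀ j, (∑ k, (g (EuclideanSpace.single k 1)) j * (x : EuclideanSpace ℝ (Fin d)) k) =
      (g x) j := by
    intro j
    conv_rhs => rw [← (EuclideanSpace.basisFun (Fin d) ℝ).sum_repr (x : EuclideanSpace ℝ (Fin d))]
    simp [mul_comm]
  simp only [sphereEval, substLinear, coe_sphereMap]
  rw [MvPolynomial.aeval_def, ← MvPolynomial.coe_eval₂Hom, ← RingHom.comp_apply]
  congr 1
  apply MvPolynomial.ringHom_ext
  · simp
  · simp [h]

theorem MvPolynomial.IsHomogeneous.eval₂_mul {σ R S : Type*} [CommSemiring R] [CommSemiring S]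
    {p : MvPolynomial σ R} {t : ℕ} (hp : p.IsHomogeneous t) (f : R →+* S) (c : S) (v : σ → S) :
    p.eval₂ f (fun i => c * v i) = c ^ t * p.eval₂ f v := by
  rw [MvPolynomial.eval₂_eq, MvPolynomial.eval₂_eq, Finset.mul_sum]
  refine Finset.sum_congr rfl fun m hm => ?_
  have h := hp.degree_eq_sum_deg_support hm
  simp only [mul_pow, Finset.prod_mul_distrib, Finset.prod_pow_eq_pow_sum]
  rw [h]
  ring

theorem sphereEval_neg_isometry {d t : ℕ} (ht : Odd t) {p : MvPolynomial (Fin d) ℝ}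
    (hp : p.IsHomogeneous t) (x : UnitSphere d) :
    sphereEval p (sphereMap (LinearIsometryEquiv.neg ℝ) x) = -sphereEval p x := by
  have h := hp.eval₂_mul (RingHom.id ℝ) (-1) (fun j => (x : EuclideanSpace ℝ (Fin d)) j)
  rw [ht.neg_one_pow] at h
  have e : ∀ j, (sphereMap (LinearIsometryEquiv.neg ℝ) x : EuclideanSpace ℝ (Fin d)) j =
      -1 * (x : EuclideanSpace ℝ (Fin d)) j := fun j => by simp
  rw [sphereEval, sphereEval, ← neg_one_mul (MvPolynomial.eval _ p)]
  simp only [e]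
  exact h

theorem integral_sphereEval_eq_zero {d t : ℕ} (ht : Odd t) {p : MvPolynomial (Fin d) ℝ}
    (hp : p.IsHomogeneous t) : ∫ x, sphereEval p x ∂(uniformSphere d) = 0 := by
  have h := integral_comp_sphereMap (LinearIsometryEquiv.neg ℝ) (sphereEval p)
  simp only [sphereEval_neg_isometry ht hp, integral_neg] at h
  linarith

/-- The reflection in the hyperplane orthogonal to `x - y` exchanges the two points. -/
theorem exists_isometry_eq {d : ℕ} (x y : UnitSphere d) :
    ∃ g : EuclideanSpace ℝ (Fin d) ≃ₗᵢ[ℝ] EuclideanSpace ℝ (Fin d), sphereMap g x = y := by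
  refine ⟨Submodule.reflection (ℝ ∙ ((x : EuclideanSpace ℝ (Fin d)) - y))ᗮ, ?_⟩
  ext1
  rw [coe_sphereMap]
  exact Submodule.reflection_sub (by simp)

theorem MvPolynomial.IsHomogeneous.eq_zero_of_sphereEval {d t : ℕ} [NeZero d]
    {p : MvPolynomial (Fin d) ℝ} (hp : p.IsHomogeneous t) (h : ∀ x, sphereEval p x = 0) :
    p = 0 := by
  apply MvPolynomial.funext
  intro v
  rw [map_zero]
  obtain ⟨c, x, hx⟩ : ∃ (c : ℝ) (x : UnitSphere d), v = fun j => c * x.1 j := by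
    by_cases hv : v = 0
    · refine ⟨0, ⟨EuclideanSpace.single 0 1, by simp⟩, ?_⟩
      ext j
      simp [hv]
    · have hv' : WithLp.toLp 2 v ≠ 0 := by simpa using hv
      refine ⟨‖WithLp.toLp 2 v‖, ⟨‖WithLp.toLp 2 v‖⁻¹ • WithLp.toLp 2 v, ?_⟩, ?_⟩
      · simp [norm_smul, hv]
      · ext j
        have := norm_ne_zero_iff.2 hv'
        simp
        field_simp
  have h1 := hp.eval₂_mul (RingHom.id ℝ) c (fun j => x.1 j)
  have h2 := h x
  rw [sphereEval, MvPolynomial.eval, MvPolynomial.coe_eval₂Hom] at h2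
  rw [h2, mul_zero] at h1
  rw [hx]
  exact h1

/-! ### Homogeneous polynomials as a finite-dimensional subspace of L² of the sphere -/

theorem finrank_homogeneousSubmodule_le (t d : ℕ) [NeZero d] :
    Module.finrank ℝ (MvPolynomial.homogeneousSubmodule (Fin d) ℝ t) ≤ homogDim t d := by
  classical
  set s : Finset (MvPolynomial (Fin d) ℝ) :=
    (Finset.univ.finsuppAntidiag t).image fun m => MvPolynomial.monomial m (1 : ℝ)
  have hle : MvPolynomial.homogeneousSubmodule (Fin d) ℝ t ≤ Submodule.span ℝ s := by
    intro p hp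
    rw [p.as_sum]
    refine Submodule.sum_mem _ fun m hm => ?_
    have h := MvPolynomial.IsHomogeneous.degree_eq_sum_deg_support hp hm
    have : MvPolynomial.monomial m (p.coeff m) = p.coeff m • MvPolynomial.monomial m (1 : ℝ) := by
      rw [MvPolynomial.smul_monomial, smul_eq_mul, mul_one]
    rw [this]
    refine Submodule.smul_mem _ _ (Submodule.subset_span ?_)
    simp only [s, Finset.coe_image, Set.mem_image, Finset.mem_coe, Finset.mem_finsuppAntidiag]
    refine ⟨m, ⟨?_, Finset.subset_univ _⟩, rfl⟩
    rw [h]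
    exact (Finset.sum_subset (Finset.subset_univ _) (by simp)).symm
  calc _ ≤ _ := Submodule.finrank_mono hle
    _ ≤ s.card := finrank_span_finset_le_card s
    _ ≤ _ := Finset.card_image_le
    _ = (d + t - 1).choose t := by simp [Finset.card_finsuppAntidiag_nat_eq_choose]
    _ = homogDim t d := by
      have := Nat.pos_of_neZero d
      rw [homogDim, add_comm t d]
      exact Nat.choose_symm_of_eq_add (by omega)

/-- A family of homogeneous polynomials of degree `t` that is an orthonormal basis of the space of
all such polynomials, for the inner product of `L²` of the sphere. -/
structure SphereOrthonormalBasis (t d n : ℕ) where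
  /-- The polynomials of the basis. -/
  poly : Fin n → MvPolynomial (Fin d) ℝ
  isHomogeneous : ∀ i, (poly i).IsHomogeneous t
  orthonormal : ∀ i j, ∫ x, sphereEval (poly i) x * sphereEval (poly j) x ∂(uniformSphere d) =
    if i = j then 1 else 0
  sum_repr : ∀ p : MvPolynomial (Fin d) ℝ, p.IsHomogeneous t →
    p = ∑ j, (∫ x, sphereEval (poly j) x * sphereEval p x ∂(uniformSphere d)) • poly j

theorem integrable_sphereEval_mul {d : ℕ} [NeZero d] (p q : MvPolynomial (Fin d) ℝ) :
    Integrable (fun x => sphereEval p x * sphereEval q x) (uniformSphere d) :=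
  integrable_of_continuous ((continuous_sphereEval p).mul (continuous_sphereEval q))

/-- The inner product of `L²` of the sphere on homogeneous polynomials. -/
@[reducible]
noncomputable def sphereInnerCore (t d : ℕ) [NeZero d] :
    InnerProductSpace.Core ℝ (MvPolynomial.homogeneousSubmodule (Fin d) ℝ t) where
  inner p q := ∫ x, sphereEval p.1 x * sphereEval q.1 x ∂(uniformSphere d)
  conj_inner_symm p q := by simp [mul_comm]
  re_inner_nonneg p := integral_nonneg fun x => mul_self_nonneg _
  add_left p q r := by
    simp only [Submodule.coe_add, sphereEval_add, add_mul]
    exact integral_add (integrable_sphereEval_mul _ _) (integrable_sphereEval_mul _ _)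
  smul_left p q c := by
    simp only [Submodule.coe_smul, sphereEval_smul, mul_assoc, integral_const_mul, conj_trivial]
  definite p h := by
    have hc : Continuous fun x => sphereEval p.1 x * sphereEval p.1 x :=
      (continuous_sphereEval _).mul (continuous_sphereEval _)
    rw [integral_eq_zero_iff_of_nonneg (fun x => mul_self_nonneg _)
      (integrable_of_continuous hc)] at h
    -- A continuous function that vanishes almost everywhere vanishes everywhere, because nonempty
    -- open sets have positive measure.
    have h' := (hc.ae_eq_iff_eq _ continuous_zero).1 h
    ext1
    exact MvPolynomial.IsHomogeneous.eq_zero_of_sphereEval p.2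
      fun x => mul_self_eq_zero.1 (congrFun h' x)

theorem exists_sphereOrthonormalBasis (t d : ℕ) [NeZero d] :
    ∃ n ≤ homogDim t d, Nonempty (SphereOrthonormalBasis t d n) := by
  let W := MvPolynomial.homogeneousSubmodule (Fin d) ℝ t
  let _ : NormedAddCommGroup W := (sphereInnerCore t d).toNormedAddCommGroup
  let _ : InnerProductSpace ℝ W := InnerProductSpace.ofCore (sphereInnerCore t d).toCore
  have _ : FiniteDimensional ℝ W :=
    Module.Finite.iff_fg.2 (MvPolynomial.homogeneousSubmodule_fg (Fin d) ℝ t)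
  let b := stdOrthonormalBasis ℝ W
  refine ⟨_, finrank_homogeneousSubmodule_le t d, ⟨⟨fun i => (b i).1, fun i => (b i).2, ?_, ?_⟩⟩⟩
  · exact fun i j => orthonormal_iff_ite.1 b.orthonormal i j
  · intro p hp
    have h := congrArg Subtype.val (b.sum_repr' ⟨p, hp⟩)
    rw [Submodule.coe_sum] at h
    exact h.symm

/-- The squared norm of a polynomial in `L²` of the sphere. -/
noncomputable def sphereNormSq {d : ℕ} (p : MvPolynomial (Fin d) ℝ) : ℝ :=
  ∫ x, sphereEval p x ^ 2 ∂(uniformSphere d)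

theorem sphereNormSq_nonneg {d : ℕ} (p : MvPolynomial (Fin d) ℝ) : 0 ≤ sphereNormSq p :=
  integral_nonneg fun _ => sq_nonneg _

theorem integrable_sphereEval_sq {d : ℕ} [NeZero d] (p : MvPolynomial (Fin d) ℝ) :
    Integrable (fun x => sphereEval p x ^ 2) (uniformSphere d) :=
  integrable_of_continuous ((continuous_sphereEval p).pow 2)

@[simp]
theorem sphereNormSq_substLinear {d : ℕ}
    (g : EuclideanSpace ℝ (Fin d) ≃ₗᵢ[ℝ] EuclideanSpace ℝ (Fin d)) (p : MvPolynomial (Fin d) ℝ) :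
    sphereNormSq (substLinear g p) = sphereNormSq p := by
  simp only [sphereNormSq, sphereEval_substLinear]
  exact integral_comp_sphereMap g fun x => sphereEval p x ^ 2

namespace SphereOrthonormalBasis

variable {t d n : ℕ} (e : SphereOrthonormalBasis t d n)

/-- The linear combination of the basis with given coefficients. -/
noncomputable def comb (v : Fin n → ℝ) : MvPolynomial (Fin d) ℝ := ∑ j, v j • e.poly j

theorem isHomogeneous_comb (v : Fin n → ℝ) : (e.comb v).IsHomogeneous t :=
  MvPolynomial.IsHomogeneous.sum _ _ _ fun j _ =>
    (MvPolynomial.homogeneousSubmodule (Fin d) ℝ t).smul_mem (v j) (e.isHomogeneous j)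

@[simp]
theorem sphereEval_comb (v : Fin n → ℝ) (x : UnitSphere d) :
    sphereEval (e.comb v) x = ∑ j, v j * sphereEval (e.poly j) x := by
  simp [comb]

theorem exists_comb_eq {p : MvPolynomial (Fin d) ℝ} (hp : p.IsHomogeneous t) :
    ∃ v, e.comb v = p :=
  ⟨_, (e.sum_repr p hp).symm⟩

variable [NeZero d]

@[simp]
theorem sphereNormSq_comb (v : Fin n → ℝ) : sphereNormSq (e.comb v) = ∑ j, v j ^ 2 := by
  have h : ∀ x, sphereEval (e.comb v) x ^ 2 =
      ∑ i, ∑ j, v i * v j * (sphereEval (e.poly i) x * sphereEval (e.poly j) x) := by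
    intro x
    rw [sphereEval_comb, sq, Finset.sum_mul_sum]
    exact Finset.sum_congr rfl fun i _ => Finset.sum_congr rfl fun j _ => by ring
  simp only [sphereNormSq, h]
  rw [integral_finsetSum _ fun i _ => integrable_finsetSum _ fun j _ =>
    (integrable_sphereEval_mul _ _).const_mul _]
  refine Finset.sum_congr rfl fun i _ => ?_
  rw [integral_finsetSum _ fun j _ => (integrable_sphereEval_mul _ _).const_mul _]
  simp [integral_const_mul, e.orthonormal, sq]

theorem sphereEval_sq_le_mul {p : MvPolynomial (Fin d) ℝ} (hp : p.IsHomogeneous t)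
    (x : UnitSphere d) :
    sphereEval p x ^ 2 ≤ sphereNormSq p * ∑ j, sphereEval (e.poly j) x ^ 2 := by
  obtain ⟨v, rfl⟩ := e.exists_comb_eq hp
  rw [sphereNormSq_comb, sphereEval_comb]
  exact Finset.sum_mul_sq_le_sq_mul_sq _ _ _

/-- The sum is the diagonal of the reproducing kernel, the largest value of `p(x)²` over the unit
ball. The polynomial extremal at `g x`, composed with `g`, keeps its norm and competes at `x`. -/
theorem sum_sphereEval_sq_sphereMap_le
    (g : EuclideanSpace ℝ (Fin d) ≃ₗᵢ[ℝ] EuclideanSpace ℝ (Fin d)) (x : UnitSphere d) :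
    ∑ j, sphereEval (e.poly j) (sphereMap g x) ^ 2 ≤ ∑ j, sphereEval (e.poly j) x ^ 2 := by
  set v : Fin n → ℝ := fun j => sphereEval (e.poly j) (sphereMap g x)
  have h := e.sphereEval_sq_le_mul (isHomogeneous_substLinear g (e.isHomogeneous_comb v)) x
  rw [sphereNormSq_substLinear, sphereNormSq_comb, sphereEval_substLinear, sphereEval_comb] at h
  have hv : ∑ j, v j * sphereEval (e.poly j) (sphereMap g x) = ∑ j, v j ^ 2 :=
    Finset.sum_congr rfl fun j _ => (sq _).symm
  rw [hv, sq] at h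
  have h0 : 0 ≤ ∑ j, v j ^ 2 := Finset.sum_nonneg fun j _ => sq_nonneg _
  rcases h0.eq_or_lt with h1 | h1
  · rw [← h1]
    exact Finset.sum_nonneg fun j _ => sq_nonneg _
  · exact le_of_mul_le_mul_left h h1

/-- By transitivity of the isometries the kernel diagonal is constant, and its integral is the sum
of `n` unit squared norms. -/
theorem sum_sphereEval_sq (x : UnitSphere d) : ∑ j, sphereEval (e.poly j) x ^ 2 = n := by
  have hconst : ∀ y, ∑ j, sphereEval (e.poly j) y ^ 2 = ∑ j, sphereEval (e.poly j) x ^ 2 := by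
    intro y
    obtain ⟨g, rfl⟩ := exists_isometry_eq x y
    obtain ⟨h, hh⟩ := exists_isometry_eq (sphereMap g x) x
    refine le_antisymm (e.sum_sphereEval_sq_sphereMap_le g x) ?_
    conv_lhs => rw [← hh]
    exact e.sum_sphereEval_sq_sphereMap_le h _
  have h1 : ∫ y, ∑ j, sphereEval (e.poly j) y ^ 2 ∂(uniformSphere d) = n := by
    rw [integral_finsetSum _ fun j _ => integrable_sphereEval_sq _]
    simp [sq, e.orthonormal]
  simpa [hconst] using h1

theorem sphereEval_sq_le (e : SphereOrthonormalBasis t d n) {p : MvPolynomial (Fin d) ℝ} (hp : p.IsHomogeneous t)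
    (x : UnitSphere d) : sphereEval p x ^ 2 ≤ n * sphereNormSq p := by
  have h := e.sphereEval_sq_le_mul hp x
  rwa [e.sum_sphereEval_sq, mul_comm] at h

end SphereOrthonormalBasis

/-! ### Trigonometric sums sampled at equidistributed points -/

section TrigSum

open Complex

/-- A full geometric sum over the powers of an `m`-th root of unity, which differs from 1 when `k ≠
l` since `|k - l| < m`. -/
theorem sum_exp_equidistributed {m k l : ℕ} (hk : k < m) (hl : l < m) :
    ∑ j ∈ Finset.range m, exp (I * (((k : ℝ) - l) * (2 * Real.pi * j / m) : ℝ)) =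
      if k = l then (m : ℂ) else 0 := by
  have hm : (m : ℂ) ≠ 0 := by exact_mod_cast (by omega : m ≠ 0)
  split_ifs with h
  · subst h
    simp
  set ζ : ℂ := exp (2 * Real.pi * I * ((k - l : ℤ) / m)) with hζ
  have hpow : ∀ j : ℕ, exp (I * (((k : ℝ) - l) * (2 * Real.pi * j / m) : ℝ)) = ζ ^ j := by
    intro j
    rw [hζ, ← Complex.exp_nat_mul]
    congr 1
    push_cast
    ring
  have h1 : ζ ^ m = 1 := by
    rw [hζ, ← Complex.exp_nat_mul, Complex.exp_eq_one_iff]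
    refine ⟨k - l, ?_⟩
    field_simp
  have h2 : ζ ≠ 1 := by
    rw [hζ, Ne, Complex.exp_eq_one_iff]
    rintro ⟨a, ha⟩
    have hpi : (2 * Real.pi * I : ℂ) ≠ 0 := Complex.two_pi_I_ne_zero
    rw [mul_comm (a : ℂ)] at ha
    have h3 := mul_left_cancel₀ hpi ha
    rw [div_eq_iff hm] at h3
    have h4 : (k - l : ℤ) = a * m := by exact_mod_cast h3
    have h5 : a = 0 := by
      have := Int.abs_lt_one_iff (a := a)
      rw [← this]
      have h6 : |(k - l : ℤ)| < m := by rw [abs_lt]; constructor <;> omega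
      rw [h4, abs_mul, Nat.abs_cast] at h6
      by_contra hcon
      push Not at hcon
      nlinarith
    rw [h5] at h4
    omega
  simp only [hpow]
  have := mul_neg_geom_sum ζ m
  rw [h1, sub_self] at this
  exact (mul_eq_zero.1 this).resolve_left (sub_ne_zero.2 (Ne.symm h2))

/-- Only the frequency zero, at index `k = t`, survives. That the value does not depend on `θ` is
what makes polygons into designs. -/
theorem sum_trigSum_equidistributed (t : ℕ) (c : ℕ → ℂ) (θ : ℝ) :
    ∑ j ∈ Finset.range (2 * t + 1), ∑ k ∈ Finset.range (2 * t + 1),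
      c k * exp (I * (((k : ℝ) - t) * (θ + 2 * Real.pi * j / (2 * t + 1 : ℕ)) : ℝ)) =
      (2 * t + 1 : ℕ) * c t := by
  rw [Finset.sum_comm]
  have h : ∀ k ∈ Finset.range (2 * t + 1), ∑ j ∈ Finset.range (2 * t + 1),
      c k * exp (I * (((k : ℝ) - t) * (θ + 2 * Real.pi * j / (2 * t + 1 : ℕ)) : ℝ)) =
      if k = t then (2 * t + 1 : ℕ) * c t else 0 := by
    intro k hk
    have h1 := sum_exp_equidistributed (l := t) (Finset.mem_range.1 hk) (by omega)
    have h2 : ∀ j ∈ Finset.range (2 * t + 1),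
        c k * exp (I * (((k : ℝ) - t) * (θ + 2 * Real.pi * j / (2 * t + 1 : ℕ)) : ℝ)) =
        c k * exp (I * (((k : ℝ) - t) * θ : ℝ)) *
          exp (I * (((k : ℝ) - t) * (2 * Real.pi * j / (2 * t + 1 : ℕ)) : ℝ)) := by
      intro j _
      rw [mul_assoc (c k), ← Complex.exp_add]
      congr 2
      push_cast
      ring
    rw [Finset.sum_congr rfl h2, ← Finset.mul_sum, h1]
    split_ifs with hkt
    · subst hkt
      simp [mul_comm]
    · simp
  rw [Finset.sum_congr rfl h]
  simp
  omega

/-- Discrete Parseval: `2 * t + 1` nodes are enough to separate the frequencies from `-t` to `t`. -/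
theorem sum_normSq_trigSum_equidistributed (t : ℕ) (c : ℕ → ℂ) :
    ∑ j ∈ Finset.range (2 * t + 1), ‖∑ k ∈ Finset.range (2 * t + 1),
      c k * exp (I * (((k : ℝ) - t) * (2 * Real.pi * j / (2 * t + 1 : ℕ)) : ℝ))‖ ^ 2 =
      (2 * t + 1 : ℕ) * ∑ k ∈ Finset.range (2 * t + 1), ‖c k‖ ^ 2 := by
  apply Complex.ofReal_injective
  push_cast
  simp only [← Complex.mul_conj', map_sum, map_mul, ← Complex.exp_conj, Complex.conj_I,
    Complex.conj_ofReal, map_sub, map_div₀, map_add, map_one, map_natCast, map_ofNat,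
    Finset.sum_mul_sum]
  rw [Finset.sum_comm, Finset.mul_sum]
  refine Finset.sum_congr rfl fun k hk => ?_
  rw [Finset.sum_comm]
  have h : ∀ l ∈ Finset.range (2 * t + 1), ∑ j ∈ Finset.range (2 * t + 1),
      c k * exp (I * (((k : ℝ) - t) * (2 * Real.pi * j / (2 * t + 1 : ℕ)) : ℝ)) *
      ((starRingEnd ℂ) (c l) * exp (-I *
        (((l : ℝ) - t) * (2 * Real.pi * j / (2 * t + 1 : ℕ)) : ℝ))) =
      if l = k then (2 * t + 1 : ℕ) * (c k * (starRingEnd ℂ) (c k)) else 0 := by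
    intro l hl
    have h1 := sum_exp_equidistributed (Finset.mem_range.1 hk) (Finset.mem_range.1 hl)
    have h2 : ∀ j ∈ Finset.range (2 * t + 1),
        c k * exp (I * (((k : ℝ) - t) * (2 * Real.pi * j / (2 * t + 1 : ℕ)) : ℝ)) *
        ((starRingEnd ℂ) (c l) * exp (-I *
          (((l : ℝ) - t) * (2 * Real.pi * j / (2 * t + 1 : ℕ)) : ℝ))) =
        c k * (starRingEnd ℂ) (c l) *
          exp (I * (((k : ℝ) - l) * (2 * Real.pi * j / (2 * t + 1 : ℕ)) : ℝ)) := by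
      intro j _
      rw [mul_mul_mul_comm, ← Complex.exp_add]
      congr 2
      push_cast
      ring
    rw [Finset.sum_congr rfl h2, ← Finset.mul_sum, h1]
    by_cases hkl : k = l
    · subst hkl
      simp [mul_comm]
    · simp [hkl, Ne.symm hkl]
  push_cast at h
  rw [Finset.sum_congr rfl h]
  rw [Finset.sum_ite_eq', if_pos hk]

/-- Bernstein's inequality for equidistributed quadratic means of trigonometric sums. -/
theorem sum_normSq_trigSum_sub_le (t : ℕ) (c : ℕ → ℂ) (θ : ℝ) (f : ℝ → ℂ)
    (hf : ∀ s : ℝ, f s = ∑ k ∈ Finset.range (2 * t + 1), c k * exp (I * (((k : ℝ) - t) * s : ℝ))) :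
    ∑ j ∈ Finset.range (2 * t + 1), ‖f (θ + 2 * Real.pi * j / (2 * t + 1 : ℕ)) -
      f (2 * Real.pi * j / (2 * t + 1 : ℕ))‖ ^ 2 ≤
      (t * θ) ^ 2 * ∑ j ∈ Finset.range (2 * t + 1), ‖f (2 * Real.pi * j / (2 * t + 1 : ℕ))‖ ^ 2 := by
  have h : ∀ s : ℝ, f (θ + s) - f s = ∑ k ∈ Finset.range (2 * t + 1),
      (c k * (exp (I * (((k : ℝ) - t) * θ : ℝ)) - 1)) * exp (I * (((k : ℝ) - t) * s : ℝ)) := by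
    intro s
    rw [hf, hf, ← Finset.sum_sub_distrib]
    refine Finset.sum_congr rfl fun k _ => ?_
    have : exp (I * (((k : ℝ) - t) * (θ + s) : ℝ)) =
        exp (I * (((k : ℝ) - t) * θ : ℝ)) * exp (I * (((k : ℝ) - t) * s : ℝ)) := by
      rw [← Complex.exp_add]
      congr 1
      push_cast
      ring
    rw [this]
    ring
  simp only [h]
  simp only [hf]
  rw [sum_normSq_trigSum_equidistributed, sum_normSq_trigSum_equidistributed, mul_left_comm]
  refine mul_le_mul_of_nonneg_left ?_ (by positivity)
  rw [Finset.mul_sum]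
  refine Finset.sum_le_sum fun k hk => ?_
  rw [norm_mul, mul_pow, mul_comm]
  refine mul_le_mul_of_nonneg_right ?_ (by positivity)
  refine (sq_le_sq₀ (norm_nonneg _) (abs_nonneg ((t : ℝ) * θ))).2 ?_ |>.trans_eq (sq_abs _)
  -- The shift by `θ` multiplies each coefficient by `exp (i (k - t) θ) - 1`, of modulus at most `|k
  -- - t| |θ| ≤ t |θ|`.
  refine (Real.norm_exp_I_mul_ofReal_sub_one_le).trans ?_
  rw [Real.norm_eq_abs, abs_mul, abs_mul, Nat.abs_cast]
  refine mul_le_mul_of_nonneg_right ?_ (abs_nonneg _)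
  rw [Finset.mem_range] at hk
  have : (k : ℝ) < 2 * t + 1 := by exact_mod_cast hk
  have : (k : ℝ) ≤ 2 * t := by exact_mod_cast (by omega : k ≤ 2 * t)
  rw [abs_le]
  constructor <;> linarith [Nat.cast_nonneg (α := ℝ) k]

end TrigSum

/-! ### Rotations in a plane and their orbits on the sphere -/

/-- An orthonormal pair of vectors. -/
structure OrthonormalPair (d : ℕ) where
  /-- The first vector. -/
  fst : EuclideanSpace ℝ (Fin d)
  /-- The second vector. -/
  snd : EuclideanSpace ℝ (Fin d)
  norm_fst : ‖fst‖ = 1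
  norm_snd : ‖snd‖ = 1
  inner_eq_zero : inner ℝ fst snd = 0

namespace OrthonormalPair

variable {d : ℕ} (o : OrthonormalPair d)

theorem norm_add_smul_sq (x : EuclideanSpace ℝ (Fin d)) (a b : ℝ) :
    ‖x + (a • o.fst + b • o.snd)‖ ^ 2 =
      ‖x‖ ^ 2 + 2 * (a * inner ℝ o.fst x + b * inner ℝ o.snd x) + (a ^ 2 + b ^ 2) := by
  rw [norm_add_sq_real, norm_add_sq_real (a • o.fst), inner_add_right]
  simp only [inner_smul_right, inner_smul_left, o.inner_eq_zero, norm_smul, o.norm_fst, o.norm_snd,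
    Real.norm_eq_abs, mul_one, sq_abs, real_inner_comm]
  simp

theorem inner_sq_add_inner_sq_le (x : EuclideanSpace ℝ (Fin d)) :
    (inner ℝ o.fst x) ^ 2 + (inner ℝ o.snd x) ^ 2 ≤ ‖x‖ ^ 2 := by
  have h := o.norm_add_smul_sq x (-inner ℝ o.fst x) (-inner ℝ o.snd x)
  nlinarith [sq_nonneg ‖x + ((-inner ℝ o.fst x) • o.fst + (-inner ℝ o.snd x) • o.snd)‖]

/-- The rotation by the angle `θ` in the plane of the pair, as a linear isometry. -/
noncomputable def rotationLinearIsometry (θ : ℝ) :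
    EuclideanSpace ℝ (Fin d) →ₗᵢ[ℝ] EuclideanSpace ℝ (Fin d) where
  toFun x := x + (((Real.cos θ - 1) * inner ℝ o.fst x - Real.sin θ * inner ℝ o.snd x) • o.fst +
    (Real.sin θ * inner ℝ o.fst x + (Real.cos θ - 1) * inner ℝ o.snd x) • o.snd)
  map_add' x y := by
    simp only [inner_add_right]
    module
  map_smul' c x := by
    simp only [inner_smul_right, RingHom.id_apply]
    module
  norm_map' x := by
    rw [← sq_eq_sq₀ (norm_nonneg _) (norm_nonneg _)]
    refine (o.norm_add_smul_sq x _ _).trans ?_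
    linear_combination (inner ℝ o.fst x ^ 2 + inner ℝ o.snd x ^ 2) * Real.sin_sq_add_cos_sq θ

/-- The rotation by the angle `θ` in the plane of the pair. -/
noncomputable def rotation (θ : ℝ) :
    EuclideanSpace ℝ (Fin d) ≃ₗᵢ[ℝ] EuclideanSpace ℝ (Fin d) :=
  (o.rotationLinearIsometry θ).toLinearIsometryEquiv rfl

theorem rotation_apply (θ : ℝ) (x : EuclideanSpace ℝ (Fin d)) :
    o.rotation θ x =
      x + (((Real.cos θ - 1) * inner ℝ o.fst x - Real.sin θ * inner ℝ o.snd x) • o.fst +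
        (Real.sin θ * inner ℝ o.fst x + (Real.cos θ - 1) * inner ℝ o.snd x) • o.snd) := rfl

@[simp]
theorem inner_snd_fst : inner ℝ o.snd o.fst = 0 := by
  rw [real_inner_comm, o.inner_eq_zero]

theorem rotation_rotation (s θ : ℝ) (x : EuclideanSpace ℝ (Fin d)) :
    o.rotation s (o.rotation θ x) = o.rotation (s + θ) x := by
  simp only [rotation_apply, inner_add_right, inner_smul_right, real_inner_self_eq_norm_sq,
    o.norm_fst, o.norm_snd, o.inner_eq_zero, o.inner_snd_fst, Real.cos_add, Real.sin_add]
  module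

@[simp]
theorem rotation_zero (x : EuclideanSpace ℝ (Fin d)) : o.rotation 0 x = x := by
  simp [rotation_apply]

theorem norm_rotation_sub_le (θ : ℝ) (x : EuclideanSpace ℝ (Fin d)) :
    ‖o.rotation θ x - x‖ ≤ |θ| * ‖x‖ := by
  rw [← sq_le_sq₀ (norm_nonneg _) (by positivity), mul_pow, sq_abs, rotation_apply,
    add_sub_cancel_left]
  have h := o.norm_add_smul_sq 0
    ((Real.cos θ - 1) * inner ℝ o.fst x - Real.sin θ * inner ℝ o.snd x)
    (Real.sin θ * inner ℝ o.fst x + (Real.cos θ - 1) * inner ℝ o.snd x)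
  simp only [zero_add, inner_zero_right, mul_zero, norm_zero] at h
  rw [h]
  have h1 := o.inner_sq_add_inner_sq_le x
  have h2 := Real.one_sub_sq_div_two_le_cos (x := θ)
  have h3 := Real.sin_sq_add_cos_sq θ
  have h4 := Real.cos_le_one θ
  have h5 : (0 : ℝ) ≤ (inner ℝ o.fst x) ^ 2 + (inner ℝ o.snd x) ^ 2 := by positivity
  calc _ = (2 - 2 * Real.cos θ) * ((inner ℝ o.fst x) ^ 2 + (inner ℝ o.snd x) ^ 2) := by
        linear_combination ((inner ℝ o.fst x) ^ 2 + (inner ℝ o.snd x) ^ 2) * h3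
    _ ≤ θ ^ 2 * ‖x‖ ^ 2 := mul_le_mul (by linarith) h1 h5 (sq_nonneg _)

/-- The rotation on the sphere by the angle `θ` in the plane of the pair. -/
noncomputable def sphereRotation (θ : ℝ) (x : UnitSphere d) : UnitSphere d :=
  sphereMap (o.rotation θ) x

theorem coe_sphereRotation (θ : ℝ) (x : UnitSphere d) :
    (o.sphereRotation θ x : EuclideanSpace ℝ (Fin d)) = o.rotation θ x := rfl

theorem sphereRotation_sphereRotation (s θ : ℝ) (x : UnitSphere d) :
    o.sphereRotation s (o.sphereRotation θ x) = o.sphereRotation (s + θ) x :=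
  Subtype.ext (o.rotation_rotation s θ x)

@[simp]
theorem sphereRotation_zero (x : UnitSphere d) : o.sphereRotation 0 x = x :=
  Subtype.ext (o.rotation_zero x)

theorem dist_sphereRotation_le (θ : ℝ) (x : UnitSphere d) :
    dist (o.sphereRotation θ x) x ≤ |θ| := by
  have h := o.norm_rotation_sub_le θ x
  rw [norm_eq_of_mem_sphere, mul_one] at h
  rwa [Subtype.dist_eq, dist_eq_norm]

theorem continuous_sphereRotation :
    Continuous fun z : ℝ × UnitSphere d => o.sphereRotation z.1 z.2 := by
  refine Continuous.subtype_mk ?_ _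
  simp only [rotation_apply]
  fun_prop

open Complex in
/-- A homogeneous polynomial is a trigonometric sum along the orbits of a plane rotation. -/
theorem exists_trigSum {t : ℕ} {p : MvPolynomial (Fin d) ℝ} (hp : p.IsHomogeneous t)
    (x : UnitSphere d) : ∃ c : ℕ → ℂ, ∀ s : ℝ, (sphereEval p (o.sphereRotation s x) : ℂ) =
      ∑ k ∈ Finset.range (2 * t + 1), c k * exp (I * (((k : ℝ) - t) * s : ℝ)) := by
  set X : EuclideanSpace ℝ (Fin d) := x.1
  set B : EuclideanSpace ℝ (Fin d) := (inner ℝ o.fst X) • o.fst + (inner ℝ o.snd X) • o.snd with hB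
  set D : EuclideanSpace ℝ (Fin d) := (inner ℝ o.fst X) • o.snd - (inner ℝ o.snd X) • o.fst with hD
  have hrot : ∀ s j, (o.rotation s X) j = (X - B) j + Real.cos s * B j + Real.sin s * D j := by
    intro s j
    rw [rotation_apply]
    simp [hB, hD]
    ring
  -- With `u = exp (i s)`, coordinate `j` of the orbit is `u⁻¹` times this quadratic in `u`.
  -- Homogeneity then makes `p` equal to `u⁻ᵗ` times a polynomial in `u` of degree at most `2 * t`.
  set f : Fin d → Polynomial ℂ := fun j =>
    Polynomial.C ((((B j : ℝ) : ℂ) - I * ((D j : ℝ) : ℂ)) / 2) * Polynomial.X ^ 2 +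
    Polynomial.C (((X - B) j : ℝ) : ℂ) * Polynomial.X +
    Polynomial.C ((((B j : ℝ) : ℂ) + I * ((D j : ℝ) : ℂ)) / 2) with hf
  have hdeg : ∀ j, (f j).natDegree ≤ 2 := fun j => Polynomial.natDegree_quadratic_le
  set P : MvPolynomial (Fin d) ℂ := MvPolynomial.map (algebraMap ℝ ℂ) p with hP
  have hPhom : P.IsHomogeneous t := hp.map _
  set Q : Polynomial ℂ := MvPolynomial.aeval f P with hQ
  have hQdeg : Q.natDegree < 2 * t + 1 := by
    have : Q.natDegree ≤ t * 2 :=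
      MvPolynomial.aeval_natDegree_le P hPhom.totalDegree_le f hdeg
    omega
  refine ⟨fun k => Q.coeff k, fun s => ?_⟩
  have hfs : ∀ j, (((o.rotation s X) j : ℝ) : ℂ) = exp (-(I * s)) * (f j).eval (exp (I * s)) := by
    intro j
    rw [hrot, hf]
    have h1 : exp (-(I * s)) * exp (I * s) = 1 := by rw [← Complex.exp_add]; simp
    push_cast
    rw [Complex.cos, Complex.sin, mul_comm (s : ℂ) I, neg_mul, mul_comm (s : ℂ) I]
    simp only [Polynomial.eval_add, Polynomial.eval_mul, Polynomial.eval_C, Polynomial.eval_pow,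
      Polynomial.eval_X]
    have h2 : I * I = -1 := Complex.I_mul_I
    linear_combination (-(exp (I * s) * (((B j : ℝ) : ℂ) - I * ((D j : ℝ) : ℂ)) / 2) -
      (((X - B) j : ℝ) : ℂ)) * h1
  have hev : (sphereEval p (o.sphereRotation s x) : ℂ) =
      MvPolynomial.eval₂ (RingHom.id ℂ) (fun j => (((o.rotation s X) j : ℝ) : ℂ)) P := by
    rw [hP, MvPolynomial.eval₂_map, sphereEval, coe_sphereRotation]
    exact MvPolynomial.eval₂_comp_left (algebraMap ℝ ℂ) (RingHom.id ℝ) _ p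
  have hQev : MvPolynomial.eval₂ (RingHom.id ℂ) (fun j => (f j).eval (exp (I * s))) P =
      Q.eval (exp (I * s)) := by
    rw [hQ, MvPolynomial.aeval_def, ← Polynomial.coe_evalRingHom,
      MvPolynomial.eval₂_comp_left (Polynomial.evalRingHom (exp (I * s)))]
    congr 1
    ext1 a
    simp
  rw [hev]
  simp only [hfs]
  rw [hPhom.eval₂_mul, hQev, Polynomial.eval_eq_sum_range' hQdeg, Finset.mul_sum]
  refine Finset.sum_congr rfl fun k _ => ?_
  rw [← Complex.exp_nat_mul, ← Complex.exp_nat_mul, mul_left_comm, ← Complex.exp_add]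
  congr 2
  push_cast
  ring

end OrthonormalPair

/-! ### Bernstein inequality and Lipschitz bound on the sphere -/

namespace OrthonormalPair

variable {d : ℕ} (o : OrthonormalPair d)

theorem integral_comp_sphereRotation (θ : ℝ) (f : UnitSphere d → ℝ) :
    ∫ x, f (o.sphereRotation θ x) ∂(uniformSphere d) = ∫ x, f x ∂(uniformSphere d) :=
  integral_comp_sphereMap (o.rotation θ) f

/-- A mean-square Bernstein inequality for rotations of homogeneous polynomials. -/
theorem sphereNormSq_rotation_sub_le [NeZero d] {t : ℕ} {p : MvPolynomial (Fin d) ℝ}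
    (hp : p.IsHomogeneous t) (θ : ℝ) :
    sphereNormSq (substLinear (o.rotation θ) p - p) ≤ (t * θ) ^ 2 * sphereNormSq p := by
  set S : ℕ → ℝ := fun j => 2 * Real.pi * j / (2 * t + 1 : ℕ) with hS
  have hmean : ∀ q : MvPolynomial (Fin d) ℝ,
      ∫ x, ∑ j ∈ Finset.range (2 * t + 1), sphereEval q (o.sphereRotation (S j) x) ^ 2
        ∂(uniformSphere d) = (2 * t + 1 : ℕ) * sphereNormSq q := by
    intro q
    rw [integral_finsetSum]
    · have : ∀ j, ∫ x, sphereEval q (o.sphereRotation (S j) x) ^ 2 ∂(uniformSphere d) =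
          sphereNormSq q := fun j => o.integral_comp_sphereRotation (S j) (sphereEval q · ^ 2)
      simp [this]
    · intro j _
      exact integrable_of_continuous
        (((continuous_sphereEval q).comp (continuous_sphereMap _)).pow 2)
  have hint : ∀ q : MvPolynomial (Fin d) ℝ, Integrable
      (fun x => ∑ j ∈ Finset.range (2 * t + 1), sphereEval q (o.sphereRotation (S j) x) ^ 2)
      (uniformSphere d) := by
    intro q
    refine integrable_finsetSum _ fun j _ => integrable_of_continuous
        (((continuous_sphereEval q).comp (continuous_sphereMap _)).pow 2)
  -- On the orbit of a single point the claim is the Bernstein inequality for trigonometric sums;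
  -- integrating over `x` turns each sampled term into a full norm by rotation invariance.
  have hpt : ∀ x, ∑ j ∈ Finset.range (2 * t + 1),
      sphereEval (substLinear (o.rotation θ) p - p) (o.sphereRotation (S j) x) ^ 2 ≤
      (t * θ) ^ 2 * ∑ j ∈ Finset.range (2 * t + 1),
        sphereEval p (o.sphereRotation (S j) x) ^ 2 := by
    intro x
    obtain ⟨c, hc⟩ := o.exists_trigSum hp x
    have h := sum_normSq_trigSum_sub_le t c θ _ hc
    simp only [← Complex.ofReal_sub, Complex.norm_real, Real.norm_eq_abs, sq_abs] at h
    convert h using 4 with j hj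
    rw [sphereEval_sub, sphereEval_substLinear]
    congr 2
    exact o.sphereRotation_sphereRotation _ _ _
  have hI := integral_mono (hint _) ((hint p).const_mul _) hpt
  rw [integral_const_mul, hmean, hmean, mul_left_comm] at hI
  exact le_of_mul_le_mul_left hI (by positivity)

end OrthonormalPair

/-- Gram–Schmidt on `x`, `y` spans the plane of their great circle, and the angle is `arccos ⟨x,
y⟩`. The excluded cases are those in which the two points do not determine a plane. -/
theorem exists_sphereRotation_eq {d : ℕ} (x y : UnitSphere d) (hxy : y ≠ x)
    (hxy' : (y : EuclideanSpace ℝ (Fin d)) ≠ -x) :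
    ∃ (o : OrthonormalPair d) (θ : ℝ), o.sphereRotation θ x = y ∧ |θ| ≤ 2 * dist y x := by
  obtain ⟨x, hx⟩ := x
  obtain ⟨y, hy⟩ := y
  rw [mem_sphere_zero_iff_norm] at hx hy
  simp only [ne_eq, Subtype.mk.injEq] at hxy hxy'
  set c : ℝ := inner ℝ x y with hc
  have hc1 : c < 1 := by
    rw [hc, inner_lt_one_iff_real_of_norm_eq_one hx hy]
    exact fun h => hxy h.symm
  have hc2 : -1 < c := by
    have : inner ℝ x (-y) < 1 := by
      rw [inner_lt_one_iff_real_of_norm_eq_one hx (by rwa [norm_neg])]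
      exact fun h => hxy' (by rw [h, neg_neg])
    rw [inner_neg_right, ← hc] at this
    linarith
  set w := y - c • x with hw
  have hxx : inner ℝ x x = (1 : ℝ) := by rw [real_inner_self_eq_norm_sq, hx, one_pow]
  have hwn : ‖w‖ ^ 2 = 1 - c ^ 2 := by
    rw [hw, norm_sub_sq_real, hy, norm_smul, hx, inner_smul_right, real_inner_comm, ← hc,
      Real.norm_eq_abs, mul_one, sq_abs]
    ring
  have hwpos : 0 < ‖w‖ := by
    have : 0 < ‖w‖ ^ 2 := by rw [hwn]; nlinarith
    exact lt_of_le_of_ne (norm_nonneg _) fun h => by simp [← h] at this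
  refine ⟨⟨x, ‖w‖⁻¹ • w, hx, ?_, ?_⟩, Real.arccos c, ?_, ?_⟩
  · rw [norm_smul, norm_inv, norm_norm, inv_mul_cancel₀ hwpos.ne']
  · rw [inner_smul_right, hw, inner_sub_right, inner_smul_right, hxx, ← hc]
    simp
  · ext1
    rw [OrthonormalPair.coe_sphereRotation, OrthonormalPair.rotation_apply]
    have h1 : inner ℝ (‖w‖⁻¹ • w) x = (0 : ℝ) := by
      rw [inner_smul_left, hw, inner_sub_left, inner_smul_left, hxx, real_inner_comm, ← hc]
      simp
    simp only [h1, hxx]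
    rw [Real.cos_arccos hc2.le hc1.le, Real.sin_arccos, ← hwn, Real.sqrt_sq hwpos.le]
    simp only [mul_one, mul_zero, sub_zero, add_zero, smul_smul, mul_inv_cancel₀ hwpos.ne']
    rw [hw]
    module
  · have hθ := Real.cos_le_one_sub_mul_cos_sq (x := Real.arccos c) (by
      rw [abs_of_nonneg (Real.arccos_nonneg c)]; exact Real.arccos_le_pi c)
    rw [Real.cos_arccos hc2.le hc1.le] at hθ
    have hd : dist (⟨y, by simpa using hy⟩ : UnitSphere d) ⟨x, by simpa using hx⟩ ^ 2 =
        2 - 2 * c := by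
      rw [Subtype.dist_eq, dist_eq_norm]
      change ‖y - x‖ ^ 2 = _
      rw [norm_sub_sq_real, hx, hy, real_inner_comm, ← hc]
      ring
    rw [← sq_le_sq₀ (abs_nonneg _) (by positivity), mul_pow, hd, sq_abs]
    -- From `cos θ ≤ 1 - 2 θ² / π²` and `π ≤ 4`, the squared chord `2 - 2 cos θ` is at least `θ² /
    -- 4`.
    have h4 : (1 : ℝ) / 8 ≤ 2 / Real.pi ^ 2 := by
      rw [div_le_div_iff₀ (by norm_num) (by positivity)]
      nlinarith [Real.pi_le_four, Real.pi_pos]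
    nlinarith [mul_le_mul_of_nonneg_right h4 (sq_nonneg (Real.arccos c))]

namespace SphereOrthonormalBasis

/-- Homogeneous polynomials are Lipschitz on the sphere. -/
theorem sphereEval_sub_sq_le {t d n : ℕ} [NeZero d] (e : SphereOrthonormalBasis t d n) (ht : 1 ≤ t)
    {p : MvPolynomial (Fin d) ℝ} (hp : p.IsHomogeneous t) (x y : UnitSphere d) :
    (sphereEval p y - sphereEval p x) ^ 2 ≤
      (2 * t * dist y x) ^ 2 * (n * sphereNormSq p) := by
  have ht' : (1 : ℝ) ≤ t := by exact_mod_cast ht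
  have hN := sphereNormSq_nonneg p
  rcases eq_or_ne y x with rfl | hxy
  · simp
  -- For antipodal points the distance is 2 and the pointwise bound at `x` and `y` already suffices;
  -- otherwise the Bernstein inequality is applied to the rotation taking `x` to `y`.
  by_cases hxy' : (y : EuclideanSpace ℝ (Fin d)) = -x
  · have h1 := e.sphereEval_sq_le hp x
    have h2 := e.sphereEval_sq_le hp y
    have hd : dist y x = 2 := by
      rw [Subtype.dist_eq, dist_eq_norm, hxy']
      have : -(x : EuclideanSpace ℝ (Fin d)) - x = (-2 : ℝ) • (x : EuclideanSpace ℝ (Fin d)) := by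
        module
      rw [this, norm_smul]
      simp
    rw [hd]
    have h3 : 4 * ((n : ℝ) * sphereNormSq p) ≤ (2 * t * 2) ^ 2 * (n * sphereNormSq p) :=
      mul_le_mul_of_nonneg_right (by nlinarith) (by positivity)
    nlinarith [sq_nonneg (sphereEval p y + sphereEval p x)]
  · obtain ⟨o, θ, rfl, hθ⟩ := exists_sphereRotation_eq x y hxy hxy'
    have hhom : (substLinear (o.rotation θ) p - p).IsHomogeneous t :=
      (isHomogeneous_substLinear _ hp).sub hp
    have h1 := e.sphereEval_sq_le hhom x
    rw [sphereEval_sub, sphereEval_substLinear] at h1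
    refine h1.trans ?_
    rw [mul_left_comm]
    refine mul_le_mul_of_nonneg_left ((o.sphereNormSq_rotation_sub_le hp θ).trans ?_)
      (Nat.cast_nonneg n)
    refine mul_le_mul_of_nonneg_right ?_ hN
    rw [← sq_abs, abs_mul, Nat.abs_cast]
    refine pow_le_pow_left₀ (by positivity) ?_ 2
    nlinarith

end SphereOrthonormalBasis

/-! ### Infinitesimal rotations and the Poincaré inequality -/

theorem MvPolynomial.hasDerivAt_eval_comp {σ : Type*} [Fintype σ] (p : MvPolynomial σ ℝ)
    {c : ℝ → σ → ℝ} {c' : σ → ℝ} {s : ℝ} (hc : ∀ j, HasDerivAt (fun s => c s j) (c' j) s) :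
    HasDerivAt (fun s => MvPolynomial.eval (c s) p)
      (∑ j, MvPolynomial.eval (c s) (MvPolynomial.pderiv j p) * c' j) s := by
  classical
  induction p using MvPolynomial.induction_on with
  | C a => simpa using hasDerivAt_const s a
  | add p q hp hq => simpa [add_mul, Finset.sum_add_distrib] using hp.fun_add hq
  | mul_X p i hp =>
    simp only [map_mul, MvPolynomial.eval_X]
    refine (hp.fun_mul (hc i)).congr_deriv ?_
    symm
    simp only [MvPolynomial.pderiv_mul, MvPolynomial.pderiv_X, map_add, map_mul,
      MvPolynomial.eval_X, add_mul, Finset.sum_add_distrib, Finset.sum_mul]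
    congr 1
    · exact Finset.sum_congr rfl fun j _ => by ring
    · rw [Finset.sum_eq_single i]
      · simp
      · intro j _ hj
        simp [Ne.symm hj]
      · simp

/-- The infinitesimal rotation in the plane of the coordinates `a` and `b`. -/
noncomputable def rotationDeriv {d : ℕ} (a b : Fin d) (p : MvPolynomial (Fin d) ℝ) :
    MvPolynomial (Fin d) ℝ :=
  MvPolynomial.X a * MvPolynomial.pderiv b p - MvPolynomial.X b * MvPolynomial.pderiv a p

theorem isHomogeneous_rotationDeriv {d t : ℕ} (ht : 1 ≤ t) (a b : Fin d)
    {p : MvPolynomial (Fin d) ℝ} (hp : p.IsHomogeneous t) :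
    (rotationDeriv a b p).IsHomogeneous t := by
  have h : 1 + (t - 1) = t := by omega
  have h1 := (MvPolynomial.isHomogeneous_X ℝ a).mul (hp.pderiv (i := b))
  have h2 := (MvPolynomial.isHomogeneous_X ℝ b).mul (hp.pderiv (i := a))
  rw [h] at h1 h2
  exact h1.sub h2

/-- The orthonormal pair of two coordinate vectors. -/
noncomputable def coordPair {d : ℕ} (a b : Fin d) (hab : a ≠ b) : OrthonormalPair d where
  fst := EuclideanSpace.single a 1
  snd := EuclideanSpace.single b 1
  norm_fst := by simp
  norm_snd := by simp
  inner_eq_zero := by rw [EuclideanSpace.inner_single_left]; simp [hab]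

theorem coordPair_rotation_apply {d : ℕ} {a b : Fin d} (hab : a ≠ b) (s : ℝ)
    (x : EuclideanSpace ℝ (Fin d)) (j : Fin d) :
    ((coordPair a b hab).rotation s x) j =
      x j + (((Real.cos s - 1) * x a - Real.sin s * x b) * (if j = a then 1 else 0) +
        (Real.sin s * x a + (Real.cos s - 1) * x b) * (if j = b then 1 else 0)) := by
  rw [OrthonormalPair.rotation_apply]
  simp [coordPair, EuclideanSpace.inner_single_left]

theorem hasDerivAt_sphereEval_coordPair {d : ℕ} {a b : Fin d} (hab : a ≠ b)
    (p : MvPolynomial (Fin d) ℝ) (x : UnitSphere d) (s : ℝ) :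
    HasDerivAt (fun s => sphereEval p ((coordPair a b hab).sphereRotation s x))
      (sphereEval (rotationDeriv a b p) ((coordPair a b hab).sphereRotation s x)) s := by
  set y := (coordPair a b hab).sphereRotation s x with hy
  have hc : ∀ j, HasDerivAt
      (fun s => ((coordPair a b hab).sphereRotation s x : EuclideanSpace ℝ (Fin d)) j)
      (-(y.1 b) * (if j = a then 1 else 0) + y.1 a * (if j = b then 1 else 0)) s := by
    intro j
    simp only [hy, OrthonormalPair.coe_sphereRotation, coordPair_rotation_apply]
    have h1 := (((((Real.hasDerivAt_cos s).sub_const 1).mul_const (x.1 a)).sub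
      ((Real.hasDerivAt_sin s).mul_const (x.1 b))).mul_const (if j = a then (1 : ℝ) else 0))
    have h2 := (((((Real.hasDerivAt_sin s).mul_const (x.1 a)).add
      (((Real.hasDerivAt_cos s).sub_const 1).mul_const (x.1 b)))).mul_const
        (if j = b then (1 : ℝ) else 0))
    refine ((h1.add h2).const_add (x.1 j)).congr_deriv ?_
    simp only [hab, hab.symm, if_true, if_false]
    ring
  refine (MvPolynomial.hasDerivAt_eval_comp p hc).congr_deriv ?_
  simp only [sphereEval, rotationDeriv, map_sub, map_mul, MvPolynomial.eval_X, mul_add,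
    Finset.sum_add_distrib, mul_ite, mul_one, mul_zero, Finset.sum_ite_eq', Finset.mem_univ,
    if_true]
  simp
  ring

/-- The isometry changing the signs of a set of coordinates. -/
noncomputable def signFlip {d : ℕ} (s : Finset (Fin d)) :
    EuclideanSpace ℝ (Fin d) ≃ₗᵢ[ℝ] EuclideanSpace ℝ (Fin d) :=
  LinearIsometryEquiv.piLpCongrRight 2
    fun j => if j ∈ s then LinearIsometryEquiv.neg ℝ else LinearIsometryEquiv.refl ℝ ℝ

theorem signFlip_apply {d : ℕ} (s : Finset (Fin d)) (x : EuclideanSpace ℝ (Fin d)) (j : Fin d) :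
    signFlip s x j = if j ∈ s then -x j else x j := by
  rw [signFlip, LinearIsometryEquiv.piLpCongrRight_apply]
  simp only
  split_ifs <;> simp

/-- Flipping the sign of coordinate `a` preserves the modulus of `x_a + i x_b`, so the flipped point
lies on the orbit of `x` under rotations in the plane of `a` and `b`, for any `b ≠ a`. The angle
depends on `x`. -/
theorem exists_rotation_eq_signFlip {d : ℕ} {a b : Fin d} (hab : a ≠ b) (x : UnitSphere d) :
    ∃ θ ∈ Set.Icc (-Real.pi) Real.pi,
      (coordPair a b hab).sphereRotation θ x = sphereMap (signFlip {a}) x := by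
  set z : ℂ := ⟨x.1 a, x.1 b⟩ with hz
  obtain ⟨θ, hθ, h⟩ : ∃ θ ∈ Set.Icc (-Real.pi) Real.pi,
      Complex.exp (θ * Complex.I) * z = -(starRingEnd ℂ z) := by
    by_cases h0 : z = 0
    · exact ⟨0, ⟨by linarith [Real.pi_pos], Real.pi_pos.le⟩, by simp [h0]⟩
    · refine ⟨(-(starRingEnd ℂ z) / z).arg, ⟨(Complex.neg_pi_lt_arg _).le, Complex.arg_le_pi _⟩, ?_⟩
      have h1 : ‖-(starRingEnd ℂ z) / z‖ = 1 := by
        rw [norm_div, norm_neg, RCLike.norm_conj, div_self (norm_ne_zero_iff.2 h0)]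
      have h2 := Complex.norm_mul_exp_arg_mul_I (-(starRingEnd ℂ z) / z)
      rw [h1, Complex.ofReal_one, one_mul] at h2
      rw [h2, div_mul_cancel₀ _ h0]
  refine ⟨θ, hθ, ?_⟩
  rw [Complex.exp_mul_I, ← Complex.ofReal_cos, ← Complex.ofReal_sin] at h
  have hre := congrArg Complex.re h
  have him := congrArg Complex.im h
  simp [hz] at hre him
  rw [Complex.cos_ofReal_re, Complex.sin_ofReal_re] at hre him
  ext j
  rw [OrthonormalPair.coe_sphereRotation, coordPair_rotation_apply, coe_sphereMap, signFlip_apply]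
  by_cases hja : j = a
  · subst hja
    simp only [hab, if_true, if_false, Finset.mem_singleton]
    linarith
  · by_cases hjb : j = b
    · subst hjb
      simp only [hab.symm, if_true, if_false, Finset.mem_singleton]
      linarith
    · simp [hja, hjb]

theorem sq_integral_le_measureReal_mul {α : Type*} [MeasurableSpace α] {μ : Measure α}
    [IsFiniteMeasure μ] {f : α → ℝ} (hf : Integrable f μ) (hf2 : Integrable (fun x => f x ^ 2) μ) :
    (∫ x, f x ∂μ) ^ 2 ≤ μ.real Set.univ * ∫ x, f x ^ 2 ∂μ := by
  set A := ∫ x, f x ∂μ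
  set L := μ.real Set.univ
  have h : 0 ≤ ∫ x, (L * f x - A) ^ 2 ∂μ := integral_nonneg fun x => sq_nonneg _
  have h1 : ∫ x, (L * f x - A) ^ 2 ∂μ = L * (L * ∫ x, f x ^ 2 ∂μ - A ^ 2) := by
    have : ∀ x, (L * f x - A) ^ 2 = L ^ 2 * f x ^ 2 - 2 * L * A * f x + A ^ 2 := fun x => by ring
    simp only [this]
    have i1 : Integrable (fun x => L ^ 2 * f x ^ 2) μ := hf2.const_mul _
    have i2 : Integrable (fun x => 2 * L * A * f x) μ := hf.const_mul _
    have i3 : Integrable (fun x => L ^ 2 * f x ^ 2 - 2 * L * A * f x) μ := i1.sub i2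
    rw [integral_add i3 (integrable_const _), integral_sub i1 i2, integral_const_mul, integral_const_mul,
      integral_const, smul_eq_mul]
    ring
  have hL : 0 ≤ L := measureReal_nonneg
  rcases hL.eq_or_lt with h0 | h0
  · have : μ = 0 := by
      have h2 : μ.real Set.univ = 0 := h0.symm
      rwa [measureReal_eq_zero_iff, Measure.measure_univ_eq_zero] at h2
    simp [A, this]
  · rw [h1] at h
    linarith [nonneg_of_mul_nonneg_right h h0]

/-- Fundamental theorem of calculus and Cauchy–Schwarz. The integral is extended to the whole
period, so that the bound no longer depends on `θ`. -/
theorem sub_sq_le_integral_deriv_sq {g h : ℝ → ℝ} (hg : ∀ s, HasDerivAt g (h s) s)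
    (hcont : Continuous h) {θ : ℝ} (hθ : θ ∈ Set.Icc (-Real.pi) Real.pi) :
    (g θ - g 0) ^ 2 ≤ 2 * Real.pi * ∫ s in Set.Ioc (-Real.pi) Real.pi, h s ^ 2 := by
  have hftc := intervalIntegral.integral_eq_sub_of_hasDerivAt (a := 0) (b := θ)
    (fun s _ => hg s) (hcont.intervalIntegrable _ _)
  rw [← hftc, ← sq_abs]
  have hsub : Set.uIoc 0 θ ⊆ Set.Ioc (-Real.pi) Real.pi := by
    intro s hs
    rw [Set.mem_uIoc] at hs
    have := Real.pi_pos
    rcases hs with hs | hs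
    · exact ⟨by linarith [hs.1], hs.2.trans hθ.2⟩
    · exact ⟨lt_of_le_of_lt hθ.1 hs.1, by linarith [hs.2]⟩
  have hint : ∀ {f : ℝ → ℝ}, Continuous f → IntegrableOn f (Set.Ioc (-Real.pi) Real.pi) :=
    fun hf => hf.integrableOn_Ioc
  have h0 := intervalIntegral.norm_integral_le_integral_norm_uIoc (f := h) (a := 0) (b := θ)
    (μ := volume)
  simp only [Real.norm_eq_abs] at h0
  have h1 : |∫ s in (0 : ℝ)..θ, h s| ≤ ∫ s in Set.Ioc (-Real.pi) Real.pi, |h s| :=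
    h0.trans (setIntegral_mono_set (hint hcont.abs) (ae_of_all _ fun s => abs_nonneg (h s))
        hsub.eventuallyLE)
  have h2 := sq_integral_le_measureReal_mul (hint hcont.abs)
    (by simp only [sq_abs]; exact hint (hcont.pow 2))
  simp only [sq_abs] at h2
  have h3 : (volume.restrict (Set.Ioc (-Real.pi) Real.pi)).real Set.univ = 2 * Real.pi := by
    rw [measureReal_restrict_apply_univ, Real.volume_real_Ioc_of_le (by linarith [Real.pi_pos])]
    ring
  rw [h3] at h2
  exact (pow_le_pow_left₀ (abs_nonneg _) h1 2).trans h2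

theorem OrthonormalPair.continuous_sphereEval_sphereRotation {d : ℕ} (o : OrthonormalPair d)
    (p : MvPolynomial (Fin d) ℝ) :
    Continuous fun z : ℝ × UnitSphere d => sphereEval p (o.sphereRotation z.1 z.2) :=
  (continuous_sphereEval p).comp o.continuous_sphereRotation

theorem OrthonormalPair.continuous_sphereRotation_left {d : ℕ} (o : OrthonormalPair d)
    (x : UnitSphere d) : Continuous fun s : ℝ => o.sphereRotation s x := by
  refine Continuous.subtype_mk ?_ _
  simp only [rotation_apply]
  fun_prop

theorem sphereEval_signFlip_sub_sq_le {d : ℕ} {a b : Fin d} (hab : a ≠ b)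
    (p : MvPolynomial (Fin d) ℝ) (x : UnitSphere d) :
    (sphereEval p (sphereMap (signFlip {a}) x) - sphereEval p x) ^ 2 ≤
      2 * Real.pi * ∫ s in Set.Ioc (-Real.pi) Real.pi,
        sphereEval (rotationDeriv a b p) ((coordPair a b hab).sphereRotation s x) ^ 2 := by
  obtain ⟨θ, hθ, hrot⟩ := exists_rotation_eq_signFlip hab x
  have hcont : Continuous fun s : ℝ =>
      sphereEval (rotationDeriv a b p) ((coordPair a b hab).sphereRotation s x) :=
    (continuous_sphereEval _).comp ((coordPair a b hab).continuous_sphereRotation_left x)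
  have h := sub_sq_le_integral_deriv_sq (hasDerivAt_sphereEval_coordPair hab p x) hcont hθ
  rwa [hrot, OrthonormalPair.sphereRotation_zero] at h

theorem integral_integral_sphereRotation_sq {d : ℕ} [NeZero d] (o : OrthonormalPair d)
    (q : MvPolynomial (Fin d) ℝ) :
    Integrable (fun x => ∫ s in Set.Ioc (-Real.pi) Real.pi,
      sphereEval q (o.sphereRotation s x) ^ 2) (uniformSphere d) ∧
    ∫ x, (∫ s in Set.Ioc (-Real.pi) Real.pi, sphereEval q (o.sphereRotation s x) ^ 2)
      ∂(uniformSphere d) = 2 * Real.pi * sphereNormSq q := by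
  obtain ⟨C, hC⟩ := (isCompact_univ (X := UnitSphere d)).exists_bound_of_continuousOn
    ((continuous_sphereEval q).pow 2).continuousOn
  have hcont : Continuous (Function.uncurry fun (x : UnitSphere d) (s : ℝ) =>
      sphereEval q (o.sphereRotation s x) ^ 2) :=
    ((o.continuous_sphereEval_sphereRotation q).comp continuous_swap).pow 2
  have hint : Integrable (Function.uncurry fun (x : UnitSphere d) (s : ℝ) =>
      sphereEval q (o.sphereRotation s x) ^ 2)
      ((uniformSphere d).prod (volume.restrict (Set.Ioc (-Real.pi) Real.pi))) :=
    Integrable.of_bound hcont.aestronglyMeasurable C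
      (ae_of_all _ fun z => hC _ (Set.mem_univ _))
  refine ⟨hint.integral_prod_left, ?_⟩
  rw [integral_integral_swap hint]
  have h : ∀ s, ∫ x, sphereEval q (o.sphereRotation s x) ^ 2 ∂(uniformSphere d) =
      sphereNormSq q := fun s => o.integral_comp_sphereRotation s (fun x => sphereEval q x ^ 2)
  simp only [h]
  rw [setIntegral_const, Real.volume_real_Ioc_of_le (by linarith [Real.pi_pos]), smul_eq_mul]
  ring

/-- Integrating the orbitwise bound over the sphere, every rotation contributes the same norm by
invariance; a second factor `2π` is the length of the orbit. -/
theorem sphereNormSq_signFlip_sub_le {d : ℕ} [NeZero d] {a b : Fin d} (hab : a ≠ b)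
    (p : MvPolynomial (Fin d) ℝ) :
    sphereNormSq (substLinear (signFlip {a}) p - p) ≤
      (2 * Real.pi) ^ 2 * sphereNormSq (rotationDeriv a b p) := by
  obtain ⟨hint, heq⟩ :=
    integral_integral_sphereRotation_sq (coordPair a b hab) (rotationDeriv a b p)
  have hle := integral_mono (integrable_sphereEval_sq (substLinear (signFlip {a}) p - p))
    (hint.const_mul (2 * Real.pi)) fun x => by
      rw [sphereEval_sub, sphereEval_substLinear]
      exact sphereEval_signFlip_sub_sq_le hab p x
  rw [integral_const_mul, heq] at hle
  refine hle.trans_eq ?_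
  ring

/-- Flipping the coordinates one after another leads from `x` to `-x`, where an odd `p` changes by
`-2 p(x)`. Telescope, apply Cauchy–Schwarz to the `d` steps, and integrate. -/
theorem four_mul_sphereNormSq_le {d t : ℕ} [NeZero d] (ht : Odd t) {p : MvPolynomial (Fin d) ℝ}
    (hp : p.IsHomogeneous t) :
    4 * sphereNormSq p ≤ d * ∑ a : Fin d, sphereNormSq (substLinear (signFlip {a}) p - p) := by
  set T : ℕ → UnitSphere d → UnitSphere d := fun k =>
    sphereMap (signFlip (Finset.univ.filter fun j : Fin d => j.1 < k)) with hT
  have hT0 : ∀ x, T 0 x = x := by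
    intro x
    ext j
    rw [hT, coe_sphereMap, signFlip_apply]
    simp
  have hTd : ∀ x, T d x = sphereMap (LinearIsometryEquiv.neg ℝ) x := by
    intro x
    ext j
    rw [hT, coe_sphereMap, signFlip_apply]
    simp
  have hTs : ∀ (a : Fin d) x, T (a + 1) x = sphereMap (signFlip {a}) (T a x) := by
    intro a x
    ext j
    rw [hT, coe_sphereMap, signFlip_apply, coe_sphereMap, signFlip_apply, coe_sphereMap,
      signFlip_apply]
    simp only [Finset.mem_filter, Finset.mem_univ, true_and, Finset.mem_singleton]
    rcases lt_trichotomy j a with h | h | h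
    · simp [h, h.ne, Nat.lt_succ_of_lt (Fin.lt_def.1 h)]
    · simp [h]
    · have h1 : ¬ (j.1 < a.1 + 1) := by have := Fin.lt_def.1 h; omega
      simp [h.not_gt, h.ne', h1]
  have hpt : ∀ x, 4 * sphereEval p x ^ 2 ≤
      d * ∑ a : Fin d, sphereEval (substLinear (signFlip {a}) p - p) (T a x) ^ 2 := by
    intro x
    have htel : ∑ a : Fin d, sphereEval (substLinear (signFlip {a}) p - p) (T a x) =
        -2 * sphereEval p x := by
      simp only [sphereEval_sub, sphereEval_substLinear, ← hTs]
      rw [Fin.sum_univ_eq_sum_range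
        (fun k => sphereEval p (T (k + 1) x) - sphereEval p (T k x)) d,
        Finset.sum_range_sub (fun k => sphereEval p (T k x)), hT0, hTd,
        sphereEval_neg_isometry ht hp]
      ring
    have hcs := sq_sum_le_card_mul_sum_sq (s := (Finset.univ : Finset (Fin d)))
      (f := fun a => sphereEval (substLinear (signFlip {a}) p - p) (T a x))
    rw [htel, Finset.card_univ, Fintype.card_fin] at hcs
    linarith
  have hint : ∀ a : Fin d, Integrable
      (fun x => sphereEval (substLinear (signFlip {a}) p - p) (T a x) ^ 2) (uniformSphere d) :=
    fun a => integrable_of_continuous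
      (((continuous_sphereEval _).comp (continuous_sphereMap _)).pow 2)
  have hI := integral_mono ((integrable_sphereEval_sq p).const_mul 4)
    ((integrable_finsetSum Finset.univ fun a _ => hint a).const_mul (d : ℝ)) hpt
  rw [integral_const_mul, integral_const_mul, integral_finsetSum _ fun a _ => hint a] at hI
  refine hI.trans_eq ?_
  congr 1
  exact Finset.sum_congr rfl fun a _ => integral_comp_sphereMap _
    (fun x => sphereEval (substLinear (signFlip {a}) p - p) x ^ 2)

/-- A Poincaré inequality: an odd homogeneous polynomial is controlled by its derivative along
one of the coordinate rotations. -/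
theorem exists_sphereNormSq_le_rotationDeriv {d t : ℕ} (hd : 2 ≤ d) (ht : Odd t)
    {p : MvPolynomial (Fin d) ℝ} (hp : p.IsHomogeneous t) :
    ∃ a b : Fin d, a ≠ b ∧
      sphereNormSq p ≤ (Real.pi * d) ^ 2 * sphereNormSq (rotationDeriv a b p) := by
  have : NeZero d := ⟨by omega⟩
  have : Nontrivial (Fin d) := Fin.nontrivial_iff_two_le.2 hd
  by_contra! hcon
  -- One arbitrary partner `f a ≠ a` per coordinate is enough. If all these derivatives were too
  -- small, the `d` flips would contribute less than `4 * sphereNormSq p` in total.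
  choose f hf using fun a : Fin d => exists_ne a
  have hdpos : (0 : ℝ) < d := by exact_mod_cast (by omega : 0 < d)
  have h1 := four_mul_sphereNormSq_le ht hp
  have h2 : ∑ a : Fin d, sphereNormSq (substLinear (signFlip {a}) p - p) <
      ∑ a : Fin d, 4 * sphereNormSq p / d ^ 2 := by
    refine Finset.sum_lt_sum_of_nonempty Finset.univ_nonempty fun a _ => ?_
    have h3 := sphereNormSq_signFlip_sub_le (hf a).symm p
    have h4 := hcon a (f a) (hf a).symm
    refine h3.trans_lt ?_
    rw [lt_div_iff₀ (by positivity)]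
    nlinarith
  rw [Finset.sum_const, Finset.card_univ, Fintype.card_fin, nsmul_eq_mul] at h2
  have h5 := mul_lt_mul_of_pos_left h2 hdpos
  have h6 : (d : ℝ) * (d * (4 * sphereNormSq p / d ^ 2)) = 4 * sphereNormSq p := by
    field_simp
  linarith

/-! ### Descent and penalised minimisation -/

theorem HasDerivAt.nonneg_of_forall_pos_le {G : ℝ → ℝ} {c : ℝ} (hG : HasDerivAt G c 0)
    (h : ∀ s > 0, G 0 ≤ G s) : 0 ≤ c := by
  refine ge_of_tendsto hG.tendsto_slope_zero_right ?_
  filter_upwards [self_mem_nhdsWithin] with s hs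
  rw [zero_add, smul_eq_mul]
  exact mul_nonneg (inv_nonneg.2 (le_of_lt hs)) (sub_nonneg.2 (h s hs))

/-- A tuple of points of the sphere as a vector of the Euclidean product. -/
noncomputable def tupleVec {d r : ℕ} (z : Fin r → UnitSphere d) :
    PiLp 2 (fun _ : Fin r => EuclideanSpace ℝ (Fin d)) :=
  WithLp.toLp 2 fun i => (z i : EuclideanSpace ℝ (Fin d))

theorem continuous_tupleVec {d r : ℕ} : Continuous (tupleVec (d := d) (r := r)) := by
  refine (PiLp.continuous_toLp 2 _).comp ?_
  fun_prop

theorem norm_tupleVec_sub_sq {d r : ℕ} (z w : Fin r → UnitSphere d) :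
    ‖tupleVec z - tupleVec w‖ ^ 2 = ∑ i, dist (z i) (w i) ^ 2 := by
  rw [PiLp.norm_sq_eq_of_L2]
  exact Finset.sum_congr rfl fun i _ => by rw [Subtype.dist_eq, dist_eq_norm]; rfl

theorem rotationDeriv_sum_smul {d : ℕ} (a b : Fin d) {ι : Type*} (s : Finset ι) (v : ι → ℝ)
    (p : ι → MvPolynomial (Fin d) ℝ) :
    rotationDeriv a b (∑ j ∈ s, v j • p j) = ∑ j ∈ s, v j • rotationDeriv a b (p j) := by
  simp only [rotationDeriv, map_sum, Derivation.map_smul, Finset.mul_sum, smul_sub, Finset.sum_sub_distrib,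
    mul_smul_comm]

namespace SphereOrthonormalBasis

variable {t d n r : ℕ} (e : SphereOrthonormalBasis t d n)

/-- The averages of the basis polynomials over a tuple of points. -/
noncomputable def average (z : Fin r → UnitSphere d) : EuclideanSpace ℝ (Fin n) :=
  WithLp.toLp 2 fun j => (1 / (r : ℝ)) * ∑ i, sphereEval (e.poly j) (z i)

theorem average_apply (z : Fin r → UnitSphere d) (j : Fin n) :
    e.average z j = (1 / (r : ℝ)) * ∑ i, sphereEval (e.poly j) (z i) := rfl

theorem continuous_average : Continuous (e.average (r := r)) := by
  refine (PiLp.continuous_toLp 2 _).comp (continuous_pi fun j => continuous_const.mul ?_)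
  exact continuous_finsetSum _ fun i _ => (continuous_sphereEval _).comp (continuous_apply i)

/-- The Marcinkiewicz–Zygmund inequality is stable under small perturbations in mean square. -/
theorem sphereNormSq_le_average_sq [NeZero d] (ht : 1 ≤ t) (hr : 0 < r)
    {y z : Fin r → UnitSphere d} {δ : ℝ}
    (hy : ∀ p : MvPolynomial (Fin d) ℝ, p.IsHomogeneous t →
      3 / 4 * sphereNormSq p ≤ (1 / (r : ℝ)) * ∑ i, sphereEval p (y i) ^ 2)
    (hz : ‖tupleVec z - tupleVec y‖ ^ 2 ≤ r * δ) (hδ : 8 * t ^ 2 * n * δ ≤ 1 / 4)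
    {p : MvPolynomial (Fin d) ℝ} (hp : p.IsHomogeneous t) (e : SphereOrthonormalBasis t d n) :
    1 / 4 * sphereNormSq p ≤ (1 / (r : ℝ)) * ∑ i, sphereEval p (z i) ^ 2 := by
  have hr' : (0 : ℝ) < r := by exact_mod_cast hr
  have hN := sphereNormSq_nonneg p
  have h1 := hy p hp
  -- This is `u² ≤ 2 v² + 2 (u - v)²` with the Lipschitz bound. After averaging, the error costs at
  -- most 1/4 of the norm, leaving `(3/4 - 1/4) / 2 = 1/4`.
  have h2 : ∀ i, sphereEval p (y i) ^ 2 ≤ 2 * sphereEval p (z i) ^ 2 +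
      8 * t ^ 2 * n * sphereNormSq p * dist (z i) (y i) ^ 2 := by
    intro i
    have h3 := e.sphereEval_sub_sq_le ht hp (y i) (z i)
    nlinarith [sq_nonneg (2 * sphereEval p (z i) - sphereEval p (y i))]
  have h3 := Finset.sum_le_sum fun i (_ : i ∈ Finset.univ) => h2 i
  rw [Finset.sum_add_distrib, ← Finset.mul_sum, ← Finset.mul_sum, ← norm_tupleVec_sub_sq] at h3
  have h4 : 8 * t ^ 2 * n * sphereNormSq p * ‖tupleVec z - tupleVec y‖ ^ 2 ≤
      8 * t ^ 2 * n * sphereNormSq p * (r * δ) := mul_le_mul_of_nonneg_left hz (by positivity)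
  have h5 : 8 * t ^ 2 * n * δ * (r * sphereNormSq p) ≤ 1 / 4 * (r * sphereNormSq p) :=
    mul_le_mul_of_nonneg_right hδ (by positivity)
  rw [one_div (r : ℝ), ← div_eq_inv_mul, le_div_iff₀ hr'] at h1 ⊢
  nlinarith

/-- At a tuple where the averages do not vanish, a small rotation of the points decreases the norm
of the averages. -/
theorem exists_descent (hd : 2 ≤ d) (ht : Odd t) (z : Fin r → UnitSphere d)
    (hP : e.average z ≠ 0) :
    ∃ (q : MvPolynomial (Fin d) ℝ) (w : ℝ → Fin r → UnitSphere d), q.IsHomogeneous t ∧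
      1 ≤ (Real.pi * d) ^ 2 * sphereNormSq q ∧ w 0 = z ∧
      (∀ s i, dist (w s i) (z i) ≤ |s * sphereEval q (z i)|) ∧
      HasDerivAt (fun s => ‖e.average (w s)‖)
        (-((1 / (r : ℝ)) * ∑ i, sphereEval q (z i) ^ 2)) 0 := by
  have : NeZero d := ⟨by omega⟩
  set P := e.average z
  have hPpos : 0 < ‖P‖ := norm_pos_iff.2 hP
  -- The derivative of `‖average‖` along a motion is the derivative of the average of `e.comb v`, so
  -- only this polynomial matters.
  set v : Fin n → ℝ := fun j => P j / ‖P‖ with hv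
  have hv1 : ∑ j, v j ^ 2 = 1 := by
    simp only [hv, div_pow]
    rw [← Finset.sum_div, ← EuclideanSpace.real_norm_sq_eq]
    exact div_self (by positivity)
  obtain ⟨a, b, hab, h1⟩ := exists_sphereNormSq_le_rotationDeriv hd ht (e.isHomogeneous_comb v)
  rw [e.sphereNormSq_comb, hv1] at h1
  set q := rotationDeriv a b (e.comb v) with hq
  have hqev : ∀ x, sphereEval q x = ∑ j, v j * sphereEval (rotationDeriv a b (e.poly j)) x := by
    intro x
    rw [hq, comb, rotationDeriv_sum_smul]
    simp
  set w : ℝ → Fin r → UnitSphere d := fun s i =>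
    (coordPair a b hab).sphereRotation (-(s * sphereEval q (z i))) (z i) with hw
  have hw0 : w 0 = z := by
    funext i
    simp [hw]
  refine ⟨q, w, isHomogeneous_rotationDeriv ht.pos a b (e.isHomogeneous_comb v), h1, hw0, ?_, ?_⟩
  · intro s i
    have := (coordPair a b hab).dist_sphereRotation_le (-(s * sphereEval q (z i))) (z i)
    rwa [abs_neg] at this
  have hder : ∀ j i, HasDerivAt (fun s => sphereEval (e.poly j) (w s i))
      (sphereEval (rotationDeriv a b (e.poly j)) (z i) * -sphereEval q (z i)) 0 := by
    intro j i
    have h2 := hasDerivAt_sphereEval_coordPair hab (e.poly j) (z i) 0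
    rw [OrthonormalPair.sphereRotation_zero] at h2
    have h3 : HasDerivAt (fun s : ℝ => -(s * sphereEval q (z i))) (-sphereEval q (z i)) 0 :=
      ((hasDerivAt_id (0 : ℝ)).mul_const (sphereEval q (z i))).neg.congr_deriv (by simp)
    exact HasDerivAt.comp_of_eq 0 h2 h3 (by simp)
  have havg : ∀ j, HasDerivAt (fun s => e.average (w s) j) ((1 / (r : ℝ)) *
      ∑ i, sphereEval (rotationDeriv a b (e.poly j)) (z i) * -sphereEval q (z i)) 0 := by
    intro j
    simp only [average_apply]
    exact (HasDerivAt.fun_sum fun i _ => hder j i).const_mul _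
  have hsq := HasDerivAt.fun_sum fun j (_ : j ∈ Finset.univ) => (havg j).fun_pow 2
  have hnorm : ∀ s, ‖e.average (w s)‖ = √(∑ j, (e.average (w s) j) ^ 2) := by
    intro s
    rw [← EuclideanSpace.real_norm_sq_eq, Real.sqrt_sq (norm_nonneg _)]
  have h0 : ∑ j, (e.average (w 0) j) ^ 2 = ‖P‖ ^ 2 := by
    rw [hw0, EuclideanSpace.real_norm_sq_eq]
  simp only [hnorm]
  refine (hsq.sqrt (by rw [h0]; positivity)).congr_deriv ?_
  rw [h0, Real.sqrt_sq hPpos.le, hw0]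
  have hPv : ∀ j, e.average z j = ‖P‖ * v j := by
    intro j
    simp only [hv]
    field_simp
    rfl
  simp only [hPv, Finset.mul_sum, Finset.sum_div]
  rw [Finset.sum_comm, ← Finset.sum_neg_distrib]
  refine Finset.sum_congr rfl fun i _ => ?_
  have hqq : sphereEval q (z i) ^ 2 =
      ∑ j, v j * sphereEval (rotationDeriv a b (e.poly j)) (z i) * sphereEval q (z i) := by
    rw [sq, ← Finset.sum_mul, ← hqev]
  rw [hqq, Finset.mul_sum, ← Finset.sum_neg_distrib]
  refine Finset.sum_congr rfl fun j _ => ?_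
  have := hPpos.ne'
  push_cast
  field_simp

/-- A minimiser of the norm of the averages, penalised by the distance to given points, has vanishing
averages if it satisfies a Marcinkiewicz–Zygmund inequality. -/
theorem average_eq_zero_of_forall_le (hd : 2 ≤ d) (ht : Odd t) (hr : 0 < r)
    {y z : Fin r → UnitSphere d} {l1 l2 : ℝ} (hl1 : 0 ≤ l1) (hl2 : 0 ≤ l2)
    (hl1n : 9 * √n * (Real.pi * d) * l1 ≤ 1) (hl2r : 4 * (Real.pi * d) * √r * l2 ≤ 1)
    (hmin : ∀ w : Fin r → UnitSphere d,
      ‖e.average z‖ + l1 * dist z y + l2 * ‖tupleVec z - tupleVec y‖ ≤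
        ‖e.average w‖ + l1 * dist w y + l2 * ‖tupleVec w - tupleVec y‖)
    (hz : ∀ p : MvPolynomial (Fin d) ℝ, p.IsHomogeneous t →
      1 / 4 * sphereNormSq p ≤ (1 / (r : ℝ)) * ∑ i, sphereEval p (z i) ^ 2) :
    e.average z = 0 := by
  have : NeZero d := ⟨by omega⟩
  have hr' : (0 : ℝ) < r := by exact_mod_cast hr
  by_contra hP
  obtain ⟨q, w, hq, hq1, hw0, hwd, hder⟩ := e.exists_descent hd ht z hP
  have hM4 := hz q hq
  have hMr : ∑ i, sphereEval q (z i) ^ 2 = r * ((1 / (r : ℝ)) * ∑ i, sphereEval q (z i) ^ 2) := by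
    field_simp
  have hM0 : 0 ≤ (1 / (r : ℝ)) * ∑ i, sphereEval q (z i) ^ 2 := by positivity
  generalize (1 / (r : ℝ)) * ∑ i, sphereEval q (z i) ^ 2 = M at hM4 hMr hM0 hder
  obtain ⟨m, hm0, hm2⟩ : ∃ m, 0 ≤ m ∧ m ^ 2 = M := ⟨√M, Real.sqrt_nonneg _, Real.sq_sqrt hM0⟩
  obtain ⟨Q, hQ0, hQ2⟩ : ∃ Q, 0 ≤ Q ∧ Q ^ 2 = sphereNormSq q :=
    ⟨_, Real.sqrt_nonneg _, Real.sq_sqrt (sphereNormSq_nonneg q)⟩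
  -- This bounds the growth of the sup penalty; that of the Euclidean penalty is governed by the
  -- empirical norm `m` and loses no factor `√n`.
  have hsup : ∀ i, |sphereEval q (z i)| ≤ √n * Q := by
    intro i
    have h := Real.abs_le_sqrt (e.sphereEval_sq_le hq (z i))
    rwa [← hQ2, Real.sqrt_mul (Nat.cast_nonneg n), Real.sqrt_sq hQ0] at h
  have hmove1 : ∀ s > 0, dist (w s) z ≤ s * (√n * Q) := by
    intro s hs
    rw [dist_pi_le_iff (by positivity)]
    intro i
    refine (hwd s i).trans ?_
    rw [abs_mul, abs_of_pos hs]
    exact mul_le_mul_of_nonneg_left (hsup i) hs.le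
  have hmove2 : ∀ s > 0, ‖tupleVec (w s) - tupleVec z‖ ≤ s * (√r * m) := by
    intro s hs
    rw [← sq_le_sq₀ (norm_nonneg _) (by positivity), norm_tupleVec_sub_sq, mul_pow, mul_pow,
      Real.sq_sqrt hr'.le, hm2, ← hMr, Finset.mul_sum]
    refine Finset.sum_le_sum fun i _ => ?_
    refine (pow_le_pow_left₀ dist_nonneg (hwd s i) 2).trans_eq ?_
    rw [sq_abs, mul_pow]
  have hderG : HasDerivAt (fun s => ‖e.average (w s)‖ + s * (l1 * (√n * Q) + l2 * (√r * m)))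
      (-M + 1 * (l1 * (√n * Q) + l2 * (√r * m))) 0 :=
    hder.fun_add ((hasDerivAt_id (0 : ℝ)).mul_const _)
  have hfin := hderG.nonneg_of_forall_pos_le fun s hs => by
    have h1 := hmin (w s)
    have h2 : dist (w s) y ≤ s * (√n * Q) + dist z y :=
      (dist_triangle _ z _).trans (by linarith [hmove1 s hs])
    have h3 : ‖tupleVec (w s) - tupleVec y‖ ≤ s * (√r * m) + ‖tupleVec z - tupleVec y‖ :=
      (norm_sub_le_norm_sub_add_norm_sub _ (tupleVec z) _).trans (by linarith [hmove2 s hs])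
    have h4 := mul_le_mul_of_nonneg_left h2 hl1
    have h5 := mul_le_mul_of_nonneg_left h3 hl2
    rw [hw0]
    linarith
  have hKpos : 0 < Real.pi * d := by
    have : (0 : ℝ) < d := by exact_mod_cast (by omega : 0 < d)
    positivity
  generalize Real.pi * (d : ℝ) = K at *
  have hQK : 1 ≤ K * Q := by
    rw [← hQ2, ← mul_pow] at hq1
    exact (one_le_sq_iff₀ (by positivity)).1 hq1
  have hmQ : Q / 2 ≤ m := by
    rw [← hQ2, ← hm2] at hM4
    refine abs_le_of_sq_le_sq' ?_ hm0 |>.2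
    linarith
  have hQpos : 0 < Q := by
    by_contra hcon
    have : Q = 0 := le_antisymm (not_lt.1 hcon) hQ0
    rw [this, mul_zero] at hQK
    linarith
  -- With `K = π d`, minimality gives `K m² ≤ Q/9 + m/4 ≤ 17 m / 36` as `Q ≤ 2 m`, while `K Q ≥ 1`
  -- gives `K m ≥ 1/2`, hence `K m² ≥ m/2`. Since `m > 0`, this is impossible.
  have h1 : 9 * √n * K * l1 * Q ≤ 1 * Q := mul_le_mul_of_nonneg_right hl1n hQ0
  have h2 : 4 * K * √r * l2 * m ≤ 1 * m := mul_le_mul_of_nonneg_right hl2r hm0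
  have h3 : K * M ≤ K * (1 * (l1 * (√n * Q) + l2 * (√r * m))) :=
    mul_le_mul_of_nonneg_left (by linarith) hKpos.le
  have h4 : 1 / 2 * m ≤ K * m * m := mul_le_mul_of_nonneg_right (by nlinarith) hm0
  rw [← hm2] at h3
  linarith

/-- Points with small averages that satisfy a Marcinkiewicz–Zygmund inequality can be moved to
points with vanishing averages. -/
theorem exists_average_eq_zero (hd : 2 ≤ d) (ht : Odd t) (hr : 0 < r)
    {y : Fin r → UnitSphere d} {ε : ℝ} (hε : ‖e.average y‖ ≤ ε)
    (hy : ∀ p : MvPolynomial (Fin d) ℝ, p.IsHomogeneous t →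
      3 / 4 * sphereNormSq p ≤ (1 / (r : ℝ)) * ∑ i, sphereEval p (y i) ^ 2)
    (hεt : 8 * t ^ 2 * n * (4 * (Real.pi * d) * ε) ^ 2 ≤ 1 / 4) :
    ∃ z : Fin r → UnitSphere d, e.average z = 0 ∧
      dist z y ≤ 9 * √n * (Real.pi * d) * ε := by
  have hε0 : 0 ≤ ε := (norm_nonneg _).trans hε
  have : NeZero d := ⟨by omega⟩
  rcases Nat.eq_zero_or_pos n with hn | hn
  · subst hn
    refine ⟨y, Subsingleton.elim _ _, ?_⟩
    rw [dist_self]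
    positivity
  have hn' : (0 : ℝ) < √n := Real.sqrt_pos.2 (by exact_mod_cast hn)
  have hr' : (0 : ℝ) < r := by exact_mod_cast hr
  have hsr : (0 : ℝ) < √r := Real.sqrt_pos.2 hr'
  have hd' : (0 : ℝ) < d := by exact_mod_cast (by omega : 0 < d)
  have hK : 0 < Real.pi * d := by positivity
  -- The penalties are the largest that the descent argument allows. The sup penalty bounds the
  -- final displacement; the Euclidean one keeps the mean-square displacement a factor `n` smaller,
  -- as needed to transfer the Marcinkiewicz–Zygmund inequality to `z`.
  obtain ⟨l1, hl1pos, hl1⟩ : ∃ l : ℝ, 0 < l ∧ 9 * √n * (Real.pi * d) * l = 1 :=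
    ⟨(9 * √n * (Real.pi * d))⁻¹, by positivity, mul_inv_cancel₀ (by positivity)⟩
  obtain ⟨l2, hl2pos, hl2⟩ : ∃ l : ℝ, 0 < l ∧ 4 * (Real.pi * d) * √r * l = 1 :=
    ⟨(4 * (Real.pi * d) * √r)⁻¹, by positivity, mul_inv_cancel₀ (by positivity)⟩
  have hΦc : Continuous fun z : Fin r → UnitSphere d =>
      ‖e.average z‖ + l1 * dist z y + l2 * ‖tupleVec z - tupleVec y‖ :=
    (e.continuous_average.norm.add (continuous_const.mul (continuous_id.dist
      continuous_const))).add (continuous_const.mul (continuous_tupleVec.sub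
        continuous_const).norm)
  obtain ⟨z, -, hz⟩ := (isCompact_univ (X := Fin r → UnitSphere d)).exists_isMinOn
    ⟨y, Set.mem_univ _⟩ hΦc.continuousOn
  have hmin : ∀ w : Fin r → UnitSphere d,
      ‖e.average z‖ + l1 * dist z y + l2 * ‖tupleVec z - tupleVec y‖ ≤
        ‖e.average w‖ + l1 * dist w y + l2 * ‖tupleVec w - tupleVec y‖ :=
    fun w => hz (Set.mem_univ w)
  have hΦy := hmin y
  rw [dist_self, sub_self, norm_zero, mul_zero, mul_zero, add_zero, add_zero] at hΦy
  have hd0 : 0 ≤ l1 * dist z y := by positivity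
  have hd1 : 0 ≤ l2 * ‖tupleVec z - tupleVec y‖ := by positivity
  have hd2 : 0 ≤ ‖e.average z‖ := norm_nonneg _
  have hdist2 : ‖tupleVec z - tupleVec y‖ ≤ 4 * (Real.pi * d) * √r * ε := by
    calc _ = 4 * (Real.pi * d) * √r * (l2 * ‖tupleVec z - tupleVec y‖) := by
          rw [← mul_assoc, hl2, one_mul]
      _ ≤ _ := mul_le_mul_of_nonneg_left (by linarith) (by positivity)
  refine ⟨z, e.average_eq_zero_of_forall_le hd ht hr hl1pos.le hl2pos.le hl1.le hl2.le hmin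
    fun p hp => sphereNormSq_le_average_sq ht.pos hr hy (δ := (4 * (Real.pi * d) * ε) ^ 2) ?_ hεt
      hp e, ?_⟩
  · refine (pow_le_pow_left₀ (norm_nonneg _) hdist2 2).trans_eq ?_
    linear_combination (4 * (Real.pi * d) * ε) ^ 2 * Real.sq_sqrt hr'.le
  · calc _ = 9 * √n * (Real.pi * d) * (l1 * dist z y) := by rw [← mul_assoc, hl1, one_mul]
      _ ≤ _ := mul_le_mul_of_nonneg_left (by linarith) (by positivity)

end SphereOrthonormalBasis

/-! ### Concentration of empirical averages -/

section Average

variable {d r : ℕ} {Ω : Type*} [MeasurableSpace Ω] {μ : Measure Ω}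
  {y : Fin r → Ω → UnitSphere d}

theorem memLp_comp_of_continuous [IsProbabilityMeasure μ]
    (hlaw : ∀ i, HasLaw (y i) (uniformSphere d) μ)
    {f : UnitSphere d → ℝ} (hf : Continuous f) (i : Fin r) : MemLp (fun ω => f (y i ω)) 2 μ := by
  obtain ⟨C, hC⟩ := (isCompact_univ (X := UnitSphere d)).exists_bound_of_continuousOn
    hf.continuousOn
  exact MemLp.of_bound (hf.measurable.comp_aemeasurable (hlaw i).aemeasurable).aestronglyMeasurable
    C (ae_of_all _ fun ω => hC _ (Set.mem_univ _))

theorem integral_comp_hasLaw (hlaw : ∀ i, HasLaw (y i) (uniformSphere d) μ)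
    {f : UnitSphere d → ℝ} (hf : Continuous f) (i : Fin r) :
    ∫ ω, f (y i ω) ∂μ = ∫ x, f x ∂(uniformSphere d) :=
  (hlaw i).integral_comp hf.aestronglyMeasurable

theorem integrable_sq_average_sub [IsProbabilityMeasure μ]
    (hlaw : ∀ i, HasLaw (y i) (uniformSphere d) μ)
    {f : UnitSphere d → ℝ} (hf : Continuous f) (c : ℝ) :
    Integrable (fun ω => ((1 / (r : ℝ)) * ∑ i, f (y i ω) - c) ^ 2) μ :=
  ((((memLp_finsetSum _ fun i _ => memLp_comp_of_continuous hlaw hf i).const_mul _).sub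
    (memLp_const c))).integrable_sq

/-- The left side is the variance of the empirical mean; variances of independent variables add, and
each is at most a second moment. -/
theorem integral_sq_average_sub_le [IsProbabilityMeasure μ]
    (hr : 0 < r) (hind : iIndepFun y μ)
    (hlaw : ∀ i, HasLaw (y i) (uniformSphere d) μ) {f : UnitSphere d → ℝ} (hf : Continuous f) :
    ∫ ω, ((1 / (r : ℝ)) * ∑ i, f (y i ω) - ∫ x, f x ∂(uniformSphere d)) ^ 2 ∂μ ≤
      (1 / (r : ℝ)) * ∫ x, f x ^ 2 ∂(uniformSphere d) := by
  have hr' : (r : ℝ) ≠ 0 := by exact_mod_cast hr.ne'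
  have hL := memLp_comp_of_continuous hlaw hf
  have hLs : MemLp (fun ω => ∑ i, f (y i ω)) 2 μ := memLp_finsetSum _ fun i _ => hL i
  have hmean : ∫ ω, (1 / (r : ℝ)) * ∑ i, f (y i ω) ∂μ = ∫ x, f x ∂(uniformSphere d) := by
    rw [integral_const_mul, integral_finsetSum _ fun i _ => (hL i).integrable (by norm_num)]
    simp only [integral_comp_hasLaw hlaw hf, Finset.sum_const, Finset.card_univ, Fintype.card_fin,
      nsmul_eq_mul]
    field_simp
  have hvar := variance_eq_integral (hLs.const_mul (1 / (r : ℝ))).aestronglyMeasurable.aemeasurable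
  rw [hmean] at hvar
  rw [← hvar, variance_const_mul]
  have hsum : Var[fun ω => ∑ i, f (y i ω); μ] = ∑ i, Var[fun ω => f (y i ω); μ] := by
    have h := IndepFun.variance_sum (μ := μ) (X := fun i ω => f (y i ω)) (s := Finset.univ)
      (fun i _ => hL i) fun i _ j _ hij =>
        (hind.indepFun hij).comp hf.measurable hf.measurable
    rw [← h]
    congr 1
    ext ω
    simp
  have hle : ∀ i, Var[fun ω => f (y i ω); μ] ≤ ∫ x, f x ^ 2 ∂(uniformSphere d) := by
    intro i
    refine (variance_le_expectation_sq (hL i).aestronglyMeasurable).trans_eq ?_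
    exact integral_comp_hasLaw hlaw (hf.pow 2) i
  rw [hsum]
  calc _ ≤ (1 / (r : ℝ)) ^ 2 * ∑ _i : Fin r, ∫ x, f x ^ 2 ∂(uniformSphere d) :=
        mul_le_mul_of_nonneg_left (Finset.sum_le_sum fun i _ => hle i) (by positivity)
    _ = _ := by
      rw [Finset.sum_const, Finset.card_univ, Fintype.card_fin, nsmul_eq_mul]
      field_simp

/-- Simultaneous concentration of the empirical averages of a finite family of functions. -/
theorem measure_le_sum_sq_average_sub [IsProbabilityMeasure μ]
    (hr : 0 < r) (hind : iIndepFun y μ)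
    (hlaw : ∀ i, HasLaw (y i) (uniformSphere d) μ) {ι : Type*} [Fintype ι]
    {f : ι → UnitSphere d → ℝ} (hf : ∀ k, Continuous (f k)) {b c : ℝ} (hb : 0 < b) (hc : 0 < c)
    (hfb : ∑ k, ∫ x, f k x ^ 2 ∂(uniformSphere d) ≤ b) :
    μ {ω | c * (b / r) ≤
      ∑ k, ((1 / (r : ℝ)) * ∑ i, f k (y i ω) - ∫ x, f k x ∂(uniformSphere d)) ^ 2} ≤
      ENNReal.ofReal (1 / c) := by
  have hr' : (0 : ℝ) < r := by exact_mod_cast hr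
  have hint := fun k => integrable_sq_average_sub hlaw (hf k) (∫ x, f k x ∂(uniformSphere d))
  have hI : ∫ ω, ∑ k, ((1 / (r : ℝ)) * ∑ i, f k (y i ω) -
      ∫ x, f k x ∂(uniformSphere d)) ^ 2 ∂μ ≤ b / r := by
    rw [integral_finsetSum _ fun k _ => hint k]
    refine (Finset.sum_le_sum fun k _ => integral_sq_average_sub_le hr hind hlaw (hf k)).trans ?_
    rw [← Finset.mul_sum, one_div, ← div_eq_inv_mul]
    gcongr
  have hM := mul_meas_ge_le_integral_of_nonneg
    (ae_of_all _ fun ω => Finset.sum_nonneg fun k _ => sq_nonneg _)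
    (integrable_finsetSum Finset.univ fun k _ => hint k) (c * (b / r))
  rw [ENNReal.le_ofReal_iff_toReal_le (measure_ne_top _ _) (by positivity)]
  have hbr : 0 < b / r := by positivity
  change μ.real _ ≤ _
  rw [le_div_iff₀ hc]
  refine le_of_mul_le_mul_left ?_ hbr
  calc _ = c * (b / r) * μ.real _ := by ring
    _ ≤ b / r := hM.trans hI
    _ = _ := (mul_one _).symm

end Average

namespace SphereOrthonormalBasis

variable {t d n r : ℕ} (e : SphereOrthonormalBasis t d n)

/-- The hypothesis bounds the Frobenius norm of the Gram deviation by 1/4, and Cauchy–Schwarz over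
pairs of indices bounds its quadratic form by the same constant. -/
theorem three_quarters_sphereNormSq_le [NeZero d] {y : Fin r → UnitSphere d}
    (h : ∑ k : Fin n × Fin n, ((1 / (r : ℝ)) *
      ∑ i, sphereEval (e.poly k.1) (y i) * sphereEval (e.poly k.2) (y i) -
        ∫ x, sphereEval (e.poly k.1) x * sphereEval (e.poly k.2) x ∂(uniformSphere d)) ^ 2 ≤ 1 / 16)
    {p : MvPolynomial (Fin d) ℝ} (hp : p.IsHomogeneous t) :
    3 / 4 * sphereNormSq p ≤ (1 / (r : ℝ)) * ∑ i, sphereEval p (y i) ^ 2 := by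
  obtain ⟨v, rfl⟩ := e.exists_comb_eq hp
  set D : Fin n × Fin n → ℝ := fun k => (1 / (r : ℝ)) *
      ∑ i, sphereEval (e.poly k.1) (y i) * sphereEval (e.poly k.2) (y i) -
        ∫ x, sphereEval (e.poly k.1) x * sphereEval (e.poly k.2) x ∂(uniformSphere d) with hD
  have h1 : ∑ k : Fin n × Fin n, (v k.1 * v k.2) ^ 2 = (∑ j, v j ^ 2) ^ 2 := by
    rw [sq, Finset.sum_mul_sum, Fintype.sum_prod_type]
    simp only [mul_pow]
  have h2 : ∑ k : Fin n × Fin n, v k.1 * v k.2 * D k =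
      (1 / (r : ℝ)) * ∑ i, sphereEval (e.comb v) (y i) ^ 2 - ∑ j, v j ^ 2 := by
    have h3 : ∀ x, sphereEval (e.comb v) x ^ 2 = ∑ k : Fin n × Fin n,
        v k.1 * v k.2 * (sphereEval (e.poly k.1) x * sphereEval (e.poly k.2) x) := by
      intro x
      rw [sphereEval_comb, sq, Finset.sum_mul_sum, Fintype.sum_prod_type]
      exact Finset.sum_congr rfl fun i _ => Finset.sum_congr rfl fun j _ => by ring
    have h4 : ∑ k : Fin n × Fin n, v k.1 * v k.2 *
        ∫ x, sphereEval (e.poly k.1) x * sphereEval (e.poly k.2) x ∂(uniformSphere d) =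
        ∑ j, v j ^ 2 := by
      rw [Fintype.sum_prod_type]
      simp [e.orthonormal, sq]
    rw [← h4]
    simp only [hD, mul_sub, Finset.sum_sub_distrib, h3]
    congr 1
    rw [Finset.sum_comm, Finset.mul_sum]
    refine Finset.sum_congr rfl fun k _ => ?_
    rw [← Finset.mul_sum]
    ring
  have hcs := Finset.sum_mul_sq_le_sq_mul_sq Finset.univ (fun k : Fin n × Fin n => v k.1 * v k.2) D
  rw [h1, h2] at hcs
  rw [e.sphereNormSq_comb]
  have hv : 0 ≤ ∑ j, v j ^ 2 := Finset.sum_nonneg fun j _ => sq_nonneg _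
  have h5 : (∑ j, v j ^ 2) ^ 2 * ∑ k, D k ^ 2 ≤ (1 / 4 * ∑ j, v j ^ 2) ^ 2 := by
    calc _ ≤ (∑ j, v j ^ 2) ^ 2 * (1 / 16) := mul_le_mul_of_nonneg_left h (sq_nonneg _)
      _ = _ := by ring
  have h6 := (abs_le_of_sq_le_sq' (hcs.trans h5) (by positivity)).1
  linarith

/-- The integrand is the square of the constant kernel diagonal `n`. -/
theorem sum_integral_sq_poly_mul_poly [NeZero d] :
    ∑ k : Fin n × Fin n, ∫ x, (sphereEval (e.poly k.1) x * sphereEval (e.poly k.2) x) ^ 2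
      ∂(uniformSphere d) = (n : ℝ) ^ 2 := by
  rw [← integral_finsetSum]
  · have h : ∀ x, ∑ k : Fin n × Fin n,
        (sphereEval (e.poly k.1) x * sphereEval (e.poly k.2) x) ^ 2 = (n : ℝ) ^ 2 := by
      intro x
      rw [← e.sum_sphereEval_sq x, sq, Finset.sum_mul_sum, Fintype.sum_prod_type]
      simp only [mul_pow]
    simp [h]
  · exact fun k _ => integrable_of_continuous
      (((continuous_sphereEval _).mul (continuous_sphereEval _)).pow 2)

theorem sum_integral_sq_poly [NeZero d] :
    ∑ j, ∫ x, sphereEval (e.poly j) x ^ 2 ∂(uniformSphere d) = n := by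
  simp [sq, e.orthonormal]

theorem isSphericalDesign_of_average_eq_zero (ht : Odd t) {z : Fin r → UnitSphere d}
    (hz : e.average z = 0) : IsSphericalDesign t z := by
  intro p hp
  rw [integral_sphereEval_eq_zero ht hp]
  obtain ⟨v, rfl⟩ := e.exists_comb_eq hp
  have h : ∀ j, (1 / (r : ℝ)) * ∑ i, sphereEval (e.poly j) (z i) = 0 := fun j => by
    rw [← average_apply, hz]
    rfl
  simp only [sphereEval_comb]
  rw [Finset.sum_comm, Finset.mul_sum, eq_comm]
  refine Finset.sum_eq_zero fun j _ => ?_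
  rw [← Finset.mul_sum, mul_left_comm, h, mul_zero]

end SphereOrthonormalBasis

/-! ### Explicit designs: polygons and antipodal pairs -/

theorem OrthonormalPair.sphereRotation_add_pi {d : ℕ} (o : OrthonormalPair d) (x : UnitSphere d)
    (hx : x.1 = o.fst) (s : ℝ) :
    o.sphereRotation (Real.pi + s) x =
      sphereMap (LinearIsometryEquiv.neg ℝ) (o.sphereRotation s x) := by
  ext1
  rw [add_comm, ← sphereRotation_sphereRotation, coe_sphereRotation, coe_sphereRotation,
    coe_sphereMap, coe_sphereRotation, LinearIsometryEquiv.coe_neg]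
  have h : o.rotation Real.pi x.1 = -x.1 := by
    rw [rotation_apply, hx, o.inner_snd_fst, real_inner_self_eq_norm_sq, o.norm_fst]
    simp
    module
  rw [h, map_neg]

/-- The vertices of a regular polygon with `2 * t + 1` vertices on a great circle form a spherical
`t`-design. -/
theorem OrthonormalPair.sum_polygon_eq_zero {d t : ℕ} (o : OrthonormalPair d) (ht : Odd t)
    {p : MvPolynomial (Fin d) ℝ} (hp : p.IsHomogeneous t) (x : UnitSphere d) (hx : x.1 = o.fst) :
    ∑ j ∈ Finset.range (2 * t + 1),
      sphereEval p (o.sphereRotation (2 * Real.pi * j / (2 * t + 1 : ℕ)) x) = 0 := by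
  obtain ⟨c, hc⟩ := o.exists_trigSum hp x
  have h : ∀ θ : ℝ, ((∑ j ∈ Finset.range (2 * t + 1),
      sphereEval p (o.sphereRotation (θ + 2 * Real.pi * j / (2 * t + 1 : ℕ)) x) : ℝ) : ℂ) =
      (2 * t + 1 : ℕ) * c t := by
    intro θ
    rw [← sum_trigSum_equidistributed t c θ, Complex.ofReal_sum]
    exact Finset.sum_congr rfl fun j _ => hc _
  -- The sum over the polygon is unchanged by a turn through `π`, which sends every vertex to its
  -- antipode and so negates the sum.
  have h1 := Complex.ofReal_injective ((h 0).trans (h Real.pi).symm)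
  simp only [zero_add, o.sphereRotation_add_pi x hx, sphereEval_neg_isometry ht hp,
    Finset.sum_neg_distrib] at h1
  linarith

/-- Antipodal pairs contribute zero to any odd polynomial, so they can pad a design without
disturbing it. -/
theorem exists_isSphericalDesign_add_two_mul {d t m : ℕ} [NeZero d] (ht : Odd t) (k : ℕ)
    {z : ℕ → UnitSphere d}
    (hz : ∀ p : MvPolynomial (Fin d) ℝ, p.IsHomogeneous t →
      ∑ j ∈ Finset.range m, sphereEval p (z j) = 0) :
    ∃ w : Fin (m + 2 * k) → UnitSphere d, IsSphericalDesign t w := by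
  set u : ℕ → UnitSphere d := fun i =>
    if i < m then z i else
      if Even (i - m) then z 0 else sphereMap (LinearIsometryEquiv.neg ℝ) (z 0) with hu
  refine ⟨fun i => u i, fun p hp => ?_⟩
  rw [integral_sphereEval_eq_zero ht hp, Fin.sum_univ_eq_sum_range (fun i => sphereEval p (u i)),
    Finset.sum_range_add]
  have h1 : ∑ i ∈ Finset.range m, sphereEval p (u i) = 0 := by
    rw [← hz p hp]
    refine Finset.sum_congr rfl fun i hi => ?_
    simp [hu, Finset.mem_range.1 hi]
  have h2 : ∀ k, ∑ i ∈ Finset.range (2 * k), sphereEval p (u (m + i)) = 0 := by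
    intro k
    induction k with
    | zero => simp
    | succ k ih =>
      rw [mul_add, mul_one, Finset.sum_range_succ, Finset.sum_range_succ, ih]
      have h3 : ¬ Even (2 * k + 1) := by simp
      simp [hu, h3, sphereEval_neg_isometry ht hp]
  rw [h1, h2]
  simp

theorem exists_isSphericalDesign {d t r : ℕ} (hd : 2 ≤ d) (ht : Odd t) (hr : 2 * t + 1 ≤ r) :
    ∃ w : Fin r → UnitSphere d, IsSphericalDesign t w := by
  have : NeZero d := ⟨by omega⟩
  set o : OrthonormalPair d := coordPair ⟨0, by omega⟩ ⟨1, by omega⟩ (by simp) with ho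
  set x : UnitSphere d := ⟨o.fst, by simp [o.norm_fst]⟩ with hx
  -- Antipodal pairs alone settle even `r`. For odd `r`, a polygon with the odd number `2 * t + 1`
  -- of vertices corrects the parity.
  rcases Nat.even_or_odd r with ⟨k, hk⟩ | ⟨k, hk⟩
  · obtain ⟨w, hw⟩ := exists_isSphericalDesign_add_two_mul (m := 0) ht k (z := fun _ => x)
      (fun p _ => by simp)
    have h : 0 + 2 * k = r := by omega
    subst h
    exact ⟨w, hw⟩
  · obtain ⟨w, hw⟩ := exists_isSphericalDesign_add_two_mul (m := 2 * t + 1) ht (k - t)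
      (z := fun j => o.sphereRotation (2 * Real.pi * j / (2 * t + 1 : ℕ)) x)
      (fun p hp => o.sum_polygon_eq_zero ht hp x rfl)
    have h : 2 * t + 1 + 2 * (k - t) = r := by omega
    subst h
    exact ⟨w, hw⟩

/-! ### Dimension estimates -/

/-- With `d = k + 1`, passing to degree `2 * t` gains a factor of order `d`, which absorbs the loss
`π d` in the Poincaré inequality. The induction step reduces to `(t - 1) * (k + 1) ≥ 0`. -/
theorem homogDim_mul_succ_le {t : ℕ} (ht : 1 ≤ t) (k : ℕ) :
    homogDim t (k + 1) * (k + 2) ≤ 2 * homogDim (2 * t) (k + 1) := by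
  have h : ∀ t, homogDim t (k + 1) = (t + k).choose k := fun t => rfl
  rw [h, h]
  clear h
  induction k with
  | zero => simp
  | succ k ih =>
    have h1 := Nat.add_one_mul_choose_eq (t + k) k
    have h2 := Nat.add_one_mul_choose_eq (2 * t + k) k
    rw [← add_assoc, ← add_assoc]
    refine Nat.le_of_mul_le_mul_left ?_ (by positivity : 0 < (k + 1) * (k + 2))
    calc _ = (t + k + 1).choose (k + 1) * (k + 1) * ((k + 2) * (k + 3)) := by ring
      _ = (t + k).choose k * (k + 2) * ((t + k + 1) * (k + 3)) := by rw [← h1]; ring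
      _ ≤ 2 * (2 * t + k).choose k * ((2 * t + k + 1) * (k + 2)) :=
        Nat.mul_le_mul ih (by nlinarith)
      _ = 2 * ((2 * t + k + 1).choose (k + 1) * (k + 1)) * (k + 2) := by rw [← h2]; ring
      _ = _ := by ring

theorem two_mul_add_one_le_homogDim {t d : ℕ} (hd : 2 ≤ d) : 2 * t + 1 ≤ homogDim (2 * t) d := by
  obtain ⟨k, rfl⟩ := Nat.exists_eq_add_of_le hd
  have h : homogDim (2 * t) (2 + k) = (2 * t + (1 + k)).choose (2 * t) := by
    rw [homogDim]
    have h1 : 2 * t + (2 + k) - 1 = 2 * t + (1 + k) := by omega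
    have h2 : 2 + k - 1 = 1 + k := by omega
    rw [h1, h2]
    exact Nat.choose_symm_of_eq_add rfl |>.symm
  rw [h]
  calc 2 * t + 1 = (2 * t + 1).choose (2 * t) := (Nat.choose_succ_self_right _).symm
    _ ≤ _ := Nat.choose_le_choose _ (by omega)

theorem homogDim_pos (t : ℕ) {d : ℕ} (hd : 1 ≤ d) : 0 < homogDim t d :=
  Nat.choose_pos (by omega)

/-! ### Union bound, constants and conclusion -/

/-- Covering the space by `S`, `A` and `B` uses only subadditivity, so measurability of the success
event `S` is not needed. -/
theorem ofReal_le_measure_of_compl_inter_compl_subset {Ω : Type*} [MeasurableSpace Ω] {μ : Measure Ω}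
    [IsProbabilityMeasure μ] {S A B : Set Ω} (h : Aᶜ ∩ Bᶜ ⊆ S)
    (hA : μ A ≤ ENNReal.ofReal (1 / 200)) (hB : μ B ≤ ENNReal.ofReal (1 / 200)) :
    ENNReal.ofReal (99 / 100) ≤ μ S := by
  have h1 : (Set.univ : Set Ω) ⊆ S ∪ (A ∪ B) := by
    intro ω _
    by_cases hω : ω ∈ A ∪ B
    · exact Or.inr hω
    · exact Or.inl (h ⟨fun h => hω (Or.inl h), fun h => hω (Or.inr h)⟩)
  have h2 : (1 : ENNReal) ≤ μ S + ENNReal.ofReal (1 / 100) := by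
    calc (1 : ENNReal) = μ Set.univ := measure_univ.symm
      _ ≤ μ S + (μ A + μ B) := (measure_mono h1).trans
        ((measure_union_le _ _).trans (add_le_add le_rfl (measure_union_le _ _)))
      _ ≤ μ S + (ENNReal.ofReal (1 / 200) + ENNReal.ofReal (1 / 200)) := by gcongr
      _ = _ := by rw [← ENNReal.ofReal_add (by norm_num) (by norm_num)]; norm_num
  have h3 : (1 : ENNReal) = ENNReal.ofReal (99 / 100) + ENNReal.ofReal (1 / 100) := by
    rw [← ENNReal.ofReal_add (by norm_num) (by norm_num)]; norm_num
  rw [h3] at h2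
  exact (ENNReal.add_le_add_iff_right ENNReal.ofReal_ne_top).1 h2

namespace SphereOrthonormalBasis

variable {t d n r : ℕ} (e : SphereOrthonormalBasis t d n)

/-- Points with small averages and small deviation of their Gram matrix can be moved to a spherical
design. -/
theorem exists_isSphericalDesign_of_deviation_le (hd : 2 ≤ d) (ht : Odd t) {N n' : ℝ}
    (hn' : (n : ℝ) ≤ n') (htN : 2 * t ≤ N) (hdN : n' * d ≤ 2 * N) (hN : 1024000 ≤ N)
    (hr : N ^ 5 ≤ r) {y : Fin r → UnitSphere d}
    (h1 : ∑ j, ((1 / (r : ℝ)) * ∑ i, sphereEval (e.poly j) (y i)) ^ 2 ≤ 200 * (n' / r))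
    (h2 : ∑ k : Fin n × Fin n, ((1 / (r : ℝ)) *
      ∑ i, sphereEval (e.poly k.1) (y i) * sphereEval (e.poly k.2) (y i) -
        ∫ x, sphereEval (e.poly k.1) x * sphereEval (e.poly k.2) x ∂(uniformSphere d)) ^ 2 ≤
          200 * (n' ^ 2 / r)) :
    ∃ z : Fin r → UnitSphere d, dist z y ≤ 2048000 / N ∧ IsSphericalDesign t z := by
  have : NeZero d := ⟨by omega⟩
  have hN0 : 0 < N := by linarith
  have hN5 : 0 < N ^ 5 := by positivity
  have hr' : (0 : ℝ) < r := by linarith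
  have hn0 : (0 : ℝ) ≤ n := Nat.cast_nonneg n
  have hn'0 : 0 ≤ n' := hn0.trans hn'
  have hd2 : (2 : ℝ) ≤ d := by exact_mod_cast hd
  have ht0 : (0 : ℝ) ≤ t := Nat.cast_nonneg t
  have hpi : Real.pi ^ 2 ≤ 10 := by nlinarith [Real.pi_lt_d2, Real.pi_pos]
  have hnN : n' ≤ N := by nlinarith
  have hnd : (n' * d) ^ 2 ≤ 4 * N ^ 2 := by
    calc (n' * d) ^ 2 ≤ (2 * N) ^ 2 := pow_le_pow_left₀ (by positivity) hdN 2
      _ = _ := by ring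
  have hε : ‖e.average y‖ ≤ √(200 * (n' / r)) := by
    refine Real.le_sqrt_of_sq_le ?_
    rw [EuclideanSpace.real_norm_sq_eq]
    exact h1
  have hε2 : √(200 * (n' / r)) ^ 2 = 200 * (n' / r) := Real.sq_sqrt (by positivity)
  have hMZ : 200 * (n' ^ 2 / r) ≤ 1 / 16 := by
    have h3 : n' ^ 2 ≤ N ^ 2 := pow_le_pow_left₀ hn'0 hnN 2
    have h4 : 3200 * N ^ 2 ≤ N ^ 5 := by
      calc 3200 * N ^ 2 ≤ N ^ 3 * N ^ 2 := by
            refine mul_le_mul_of_nonneg_right ?_ (sq_nonneg _)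
            have h5 : (1 : ℝ) ≤ N ^ 2 := one_le_pow₀ (by linarith)
            nlinarith
        _ = N ^ 5 := by ring
    rw [← mul_div_assoc, div_le_div_iff₀ hr' (by norm_num)]
    linarith
  -- Both smallness conditions below are multiples of this quantity; the constant is `200 * 4 * 10`,
  -- from `n' d ≤ 2 N` and `π² ≤ 10`.
  have hX : n * (Real.pi * d) ^ 2 * (200 * (n' / r)) ≤ 8000 * N ^ 2 / r := by
    rw [← mul_div_assoc, ← mul_div_assoc]
    refine div_le_div_of_nonneg_right ?_ hr'.le
    calc n * (Real.pi * d) ^ 2 * (200 * n') = (200 * Real.pi ^ 2 * (d ^ 2 * n')) * n := by ring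
      _ ≤ (200 * Real.pi ^ 2 * (d ^ 2 * n')) * n' := by gcongr
      _ = 200 * (n' * d) ^ 2 * Real.pi ^ 2 := by ring
      _ ≤ 200 * (4 * N ^ 2) * 10 := by gcongr
      _ = _ := by ring
  obtain ⟨z, hz, hzy⟩ := e.exists_average_eq_zero hd ht (by exact_mod_cast hr') hε
    (fun p hp => e.three_quarters_sphereNormSq_le (h2.trans hMZ) hp) (by
      calc 8 * (t : ℝ) ^ 2 * n * (4 * (Real.pi * d) * √(200 * (n' / r))) ^ 2
          = 128 * (t : ℝ) ^ 2 * (n * (Real.pi * d) ^ 2 * (200 * (n' / r))) := by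
            rw [mul_pow, hε2]; ring
        _ ≤ 128 * (t : ℝ) ^ 2 * (8000 * N ^ 2 / r) :=
            mul_le_mul_of_nonneg_left hX (by positivity)
        _ = 256000 * (2 * (t : ℝ)) ^ 2 * N ^ 2 / r := by ring
        _ ≤ 256000 * N ^ 2 * N ^ 2 / r := by gcongr
        -- This condition fixes the threshold: it asks for `r ≥ 1024000 * N ^ 4`, which follows from
        -- `r ≥ N ^ 5` once `N ≥ 1024000`.
        _ ≤ 1 / 4 := by
            rw [div_le_div_iff₀ hr' (by norm_num)]
            have : 1024000 * N ^ 4 ≤ N * N ^ 4 := mul_le_mul_of_nonneg_right hN (by positivity)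
            nlinarith)
  refine ⟨z, hzy.trans ?_, e.isSphericalDesign_of_average_eq_zero ht hz⟩
  rw [le_div_iff₀ hN0]
  refine (abs_le_of_sq_le_sq' ?_ (by norm_num)).2
  calc (9 * √n * (Real.pi * d) * √(200 * (n' / r)) * N) ^ 2
      = 81 * N ^ 2 * (n * (Real.pi * d) ^ 2 * (200 * (n' / r))) := by
        have := Real.sq_sqrt hn0
        rw [mul_pow, mul_pow, mul_pow, mul_pow, hε2, this]
        ring
    _ ≤ 81 * N ^ 2 * (8000 * N ^ 2 / r) := mul_le_mul_of_nonneg_left hX (by positivity)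
    _ = 648000 * N ^ 4 / r := by ring
    _ ≤ 2048000 ^ 2 := by
        rw [div_le_iff₀ hr']
        have h5 : N ^ 4 ≤ N ^ 5 := pow_le_pow_right₀ (by linarith) (by norm_num)
        nlinarith

end SphereOrthonormalBasis

theorem theorem3p6 :
    ∃ C : ℝ, 0 < C ∧
      ∀ (t d r : ℕ), Odd t → 2 ≤ d → homogDim (2 * t) d ^ 5 ≤ r →
        ∀ {Ω : Type*} [MeasurableSpace Ω] (μ : Measure Ω) [IsProbabilityMeasure μ]
          (y : Fin r → Ω → UnitSphere d),
          iIndepFun y μ → (∀ i, HasLaw (y i) (uniformSphere d) μ) →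
            ENNReal.ofReal (99 / 100) ≤
              μ {ω | ∃ z : Fin r → UnitSphere d,
                (∀ i, ‖(z i : EuclideanSpace ℝ (Fin d)) - (y i ω : EuclideanSpace ℝ (Fin d))‖
                  ≤ C / (homogDim (2 * t) d : ℝ)) ∧
                IsSphericalDesign t z} := by
  refine ⟨2048000, by norm_num, ?_⟩
  intro t d r ht hd hr Ω _ μ _ y hind hlaw
  have : NeZero d := ⟨by omega⟩
  have htN := two_mul_add_one_le_homogDim (t := t) hd
  have hNpos : 0 < homogDim (2 * t) d := by omega
  have hNr : homogDim (2 * t) d ≤ r := (Nat.le_self_pow (by norm_num) _).trans hr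
  -- The constant is twice the threshold, so below it `2048000 / N` exceeds the diameter of the
  -- sphere and one fixed design serves every outcome.
  rcases lt_or_ge (homogDim (2 * t) d) 1024000 with hN | hN
  · obtain ⟨z, hz⟩ := exists_isSphericalDesign hd ht (htN.trans hNr)
    have huniv : {ω | ∃ z : Fin r → UnitSphere d,
        (∀ i, ‖(z i : EuclideanSpace ℝ (Fin d)) - (y i ω : EuclideanSpace ℝ (Fin d))‖
          ≤ 2048000 / (homogDim (2 * t) d : ℝ)) ∧ IsSphericalDesign t z} = Set.univ := by
      refine Set.eq_univ_of_forall fun ω => ⟨z, fun i => ?_, hz⟩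
      refine (norm_sub_le _ _).trans ?_
      rw [norm_eq_of_mem_sphere, norm_eq_of_mem_sphere, le_div_iff₀ (by exact_mod_cast hNpos)]
      have : (homogDim (2 * t) d : ℝ) < 1024000 := by exact_mod_cast hN
      linarith
    rw [huniv, measure_univ]
    exact ENNReal.ofReal_le_one.2 (by norm_num)
  obtain ⟨n, hn, ⟨e⟩⟩ := exists_sphereOrthonormalBasis t d
  have hr0 : 0 < r := hNpos.trans_le hNr
  have hn' : (n : ℝ) ≤ homogDim t d := by exact_mod_cast hn
  have hn'pos : (0 : ℝ) < homogDim t d := by exact_mod_cast homogDim_pos t (by omega : 1 ≤ d)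
  have hdN : (homogDim t d : ℝ) * d ≤ 2 * homogDim (2 * t) d := by
    obtain ⟨k, rfl⟩ : ∃ k, d = k + 1 := ⟨d - 1, by omega⟩
    have h := homogDim_mul_succ_le ht.pos k
    have h' : homogDim t (k + 1) * (k + 1) ≤ 2 * homogDim (2 * t) (k + 1) :=
      (Nat.mul_le_mul_left _ (by omega)).trans h
    exact_mod_cast h'
  -- Each of the two events fails with probability at most `1 / c = 1 / 200`, for a total of 1/100.
  have hA := measure_le_sum_sq_average_sub hr0 hind hlaw (f := fun j => sphereEval (e.poly j))
    (fun j => continuous_sphereEval _) (b := homogDim t d) (c := 200) hn'pos (by norm_num)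
    (by rw [e.sum_integral_sq_poly]; exact hn')
  have hB := measure_le_sum_sq_average_sub hr0 hind hlaw
    (f := fun (k : Fin n × Fin n) x => sphereEval (e.poly k.1) x * sphereEval (e.poly k.2) x)
    (fun k => (continuous_sphereEval _).mul (continuous_sphereEval _))
    (b := (homogDim t d : ℝ) ^ 2) (c := 200) (by positivity) (by norm_num)
    (by rw [e.sum_integral_sq_poly_mul_poly]; gcongr)
  refine ofReal_le_measure_of_compl_inter_compl_subset ?_ hA hB
  rintro ω ⟨h1, h2⟩
  rw [Set.mem_compl_iff, Set.mem_ofPred_eq, not_le] at h1 h2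
  simp only [integral_sphereEval_eq_zero ht (e.isHomogeneous _), sub_zero] at h1
  obtain ⟨z, hz, hdes⟩ := e.exists_isSphericalDesign_of_deviation_le hd ht hn'
    (N := homogDim (2 * t) d) (by exact_mod_cast (by omega : 2 * t ≤ homogDim (2 * t) d)) hdN
    (by exact_mod_cast hN) (by exact_mod_cast hr) (y := fun i => y i ω) h1.le h2.le
  refine ⟨z, fun i => ?_, hdes⟩
  have := (dist_le_pi_dist z (fun i => y i ω) i).trans hz
  rwa [Subtype.dist_eq, dist_eq_norm] at this
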